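/- \textbf{Setup.} Let $X_1,X_2,\dots$ be i.i.d. random elements of a measurable space $\mathcal X$ with distribution $P_0$ (let $X\sim P_0$), defined on a probability space with probability measure $P$. Let $K\ge 1$. For $k=1,\dots,K$ let $\Theta_k\subseteq\mathbb R^{d_k}$ be open, let $\ell_k:\mathcal X\times\Theta_k\to\mathbb R$ be measurable, let $\theta_k^*\in\Theta_k$ be a minimizer of $\theta\mapsto \mathbb E\,\ell_k(X;\theta)$ over $\Theta_k$ (that is, $\mathbb E\,\ell_k(X;\theta_k^*)$ is finite and at most $\mathbb E\,\ell_k(X;\theta)$ for every $\theta\in\Theta_k$ for which the latter expectation is finite), and let $\hat\theta_k=\hat\theta_k(X_1,\dots,X_n)\in\Theta_k$ be a measurable estimator for every $n$. Put $\mu^0_k=\mathbb E\,\ell_k(X;\theta^*_k)$ and $\Sigma^0=\mathrm{Cov}\big((\ell_k(X;\theta_k^*))_{k=1}^K\big)$. \textbf{Assumptions.} (1) $\mathbb E\,\ell_k(X;\theta_k^*)^2<\infty$ for all $k$, and $\Sigma^0$ is positive definite. (2) For every $k$ there is $r>0$ such that the open ball $B=B_r(\theta_k^*)$ is contained in $\Theta_k$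 and: (a) $\mathbb E|\ell_k(X;\theta)|<\infty$ for all $\theta\in B$; (b) for every $x\in\mathcal X$, $\theta\mapsto\ell_k(x;\theta)$ is twice continuously differentiable on $B$; (c) there is $H:\mathcal X\to[0,\infty)$ with $\mathbb E\,H(X)<\infty$ and $\sup_{\theta\in B}\|\nabla^2_\theta\ell_k(x;\theta)\|\le H(x)$ for all $x$; (d) $\mathbb E\|\nabla_\theta\ell_k(X;\theta_k^*)\|^2<\infty$; (e) $\|\hat\theta_k-\theta_k^*\|=O_p(1/\sqrt n)$. \textbf{Posterior.} Let $Z_{ik}=\ell_k(X_i;\hat\theta_k)$, $Z_i=(Z_{i1},\dots,Z_{iK})^{\mathsf T}$ for $1\le i\le n$, $\overline Z_n=\frac1n\sum_{i=1}^n Z_i$, and $S_n=\frac1n\sum_{i=1}^n(Z_i-\overline Z_n)(Z_i-\overline Z_n)^{\mathsf T}$. Fix $\mu_0\in\mathbb R^K$, $\lambda_0>0$, a positive definite $\Psi_0\in\mathbb R^{K\times K}$ and $\nu_0>K-1$. Given $Z_{1:n}$, let $(\mu',\Sigma')$ have the Normal-Inverse-Wishart distribution with density $\mathcal N(\mu'\mid\mu_n,\Sigma'/\lambda_n)\,\mathrm{InverseWishart}(\Sigma'\mid\Psi_n,\nu_n)$,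 where $\lambda_n=\lambda_0+n$, $\nu_n=\nu_0+n$, $\mu_n=(\lambda_0\mu_0+n\overline Z_n)/\lambda_n$ and $\Psi_n=\Psi_0+nS_n+\frac{\lambda_0n}{\lambda_n}(\overline Z_n-\mu_0)(\overline Z_n-\mu_0)^{\mathsf T}$; here the density of $\mathrm{InverseWishart}(\Psi,\nu)$ at a positive definite $\Sigma$ is proportional to $|\Sigma|^{-(\nu+K+1)/2}e^{-\mathrm{tr}(\Psi\Sigma^{-1})/2}$. This is the posterior of the mean and covariance in the model $Z_i\overset{\mathrm{iid}}{\sim}\mathcal N(\mu,\Sigma)$ with prior $\mathrm{NIW}(\mu_0,\lambda_0,\Psi_0,\nu_0)$. \textbf{Complexity.} Let $c:\{1,\dots,K\}\to[0,\infty)$ and $\delta\ge 0$. For $\mu\in\mathbb R^K$ put $M_\delta(\mu)=\{k:\mu_k\le\min_j\mu_j+\delta\}$ and $c^*_\delta(\mu)=\min\{c(k):k\in M_\delta(\mu)\}$. \textbf{Theorem.} If $\delta\ne\mu^0_k-\min_j\mu^0_j$ for all $k=1,\dots,K$, then $$P\big(c^*_\delta(\mu')=c^*_\delta(\mu^0)\,\big|\,Z_{1:n}\big)\longrightarrow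 1\quad\text{in probability as } n\to\infty .$$ -/

import Mathlib

open MeasureTheory ProbabilityTheory Filter
open scoped ENNReal NNReal Matrix

noncomputable section

namespace LaD

/-! ### Optimality sets and minimal complexity -/

/-- The set `M_δ(m) = {k : m_k ≤ min_j m_j + δ}` of `δ`-optimal models. -/
def deltaOptimal {K : ℕ} (δ : ℝ) (m : Fin K → ℝ) : Set (Fin K) :=
  {k | m k ≤ (⨅ j, m j) + δ}

/-- The minimal complexity `c*_δ(m) = min {c(k) : k ∈ M_δ(m)}`. For `K ≥ 1` and `δ ≥ 0` the set
is finite and non-empty, so the infimum is a minimum. -/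
def minComplexity {K : ℕ} (δ : ℝ) (c : Fin K → ℝ≥0) (m : Fin K → ℝ) : ℝ≥0 :=
  sInf (c '' deltaOptimal δ m)

/-! ### The Normal-Inverse-Wishart distribution -/

/-- Symmetric `K × K` matrices, given by their `K(K+1)/2` free entries (one for every unordered
pair of indices). The volume of this function space is the Lebesgue measure
`∏_{i ≤ j} dS_{ij}`. -/
abbrev SymEntries (K : ℕ) : Type := Sym2 (Fin K) → ℝ

/-- The symmetric matrix with the given entries. -/
def symMatrix {K : ℕ} (s : SymEntries K) : Matrix (Fin K) (Fin K) ℝ :=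
  Matrix.of fun i j => s s(i, j)

/-- The density at `x` of the Gaussian distribution `N(m, S)` on `ℝ^K`, for positive definite
`S`. -/
def gaussianDensity {K : ℕ} (m : Fin K → ℝ) (S : Matrix (Fin K) (Fin K) ℝ) (x : Fin K → ℝ) : ℝ :=
  (2 * Real.pi) ^ (-(K : ℝ) / 2) * S.det ^ (-(1 / 2) : ℝ) *
    Real.exp (-(1 / 2) * ((x - m) ⬝ᵥ (S⁻¹ *ᵥ (x - m))))

open Classical in
/-- The inverse-Wishart density up to its normalizing constant,
`|S|^{-(ν+K+1)/2} exp(-tr(Ψ S⁻¹)/2)` for positive definite `S`, and `0` for other symmetric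
matrices. -/
def invWishartKernel {K : ℕ} (Ψ : Matrix (Fin K) (Fin K) ℝ) (ν : ℝ) (s : SymEntries K) : ℝ≥0∞ :=
  if (symMatrix s).PosDef then
    ENNReal.ofReal ((symMatrix s).det ^ (-(ν + K + 1) / 2) *
      Real.exp (-(1 / 2) * (Ψ * (symMatrix s)⁻¹).trace))
  else 0

/-- The density of `InverseWishart(Ψ, ν)` with respect to the Lebesgue measure on symmetric
matrices; the normalizing constant is the integral of the kernel. -/
def invWishartDensity {K : ℕ} (Ψ : Matrix (Fin K) (Fin K) ℝ) (ν : ℝ) (s : SymEntries K) : ℝ≥0∞ :=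
  invWishartKernel Ψ ν s / ∫⁻ t, invWishartKernel Ψ ν t

/-- The distribution `NIW(m, l, Ψ, ν)` on pairs (mean vector, symmetric matrix), with density
`N(x | m, S / l) · InverseWishart(S | Ψ, ν)` with respect to the Lebesgue measure. -/
def normalInvWishart {K : ℕ} (m : Fin K → ℝ) (l : ℝ) (Ψ : Matrix (Fin K) (Fin K) ℝ) (ν : ℝ) :
    Measure ((Fin K → ℝ) × SymEntries K) :=
  volume.withDensity fun p =>
    ENNReal.ofReal (gaussianDensity m (l⁻¹ • symMatrix p.2) p.1) * invWishartDensity Ψ ν p.2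

/-! ### The posterior given the data vectors -/

/-- The sample mean of `z_1, …, z_n ∈ ℝ^K`. -/
def sampleMean {K n : ℕ} (z : Fin n → Fin K → ℝ) : Fin K → ℝ :=
  (n : ℝ)⁻¹ • ∑ i, z i

/-- The sample covariance matrix (normalized by `1/n`) of `z_1, …, z_n ∈ ℝ^K`. -/
def sampleCov {K n : ℕ} (z : Fin n → Fin K → ℝ) : Matrix (Fin K) (Fin K) ℝ :=
  (n : ℝ)⁻¹ • ∑ i, Matrix.vecMulVec (z i - sampleMean z) (z i - sampleMean z)

/-- The posterior of (mean, covariance) given `z_1, …, z_n`, for the model `z_i` i.i.d.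
`N(mean, covariance)` with prior `NIW(m₀, l₀, Ψ₀, ν₀)`: the distribution `NIW(m_n, l_n, Ψ_n, ν_n)`
with the updated parameters. -/
def posterior {K n : ℕ} (m₀ : Fin K → ℝ) (l₀ : ℝ) (Ψ₀ : Matrix (Fin K) (Fin K) ℝ) (ν₀ : ℝ)
    (z : Fin n → Fin K → ℝ) : Measure ((Fin K → ℝ) × SymEntries K) :=
  normalInvWishart
    ((l₀ + n)⁻¹ • (l₀ • m₀ + (n : ℝ) • sampleMean z))
    (l₀ + n)
    (Ψ₀ + (n : ℝ) • sampleCov z +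
      (l₀ * n / (l₀ + n)) • Matrix.vecMulVec (sampleMean z - m₀) (sampleMean z - m₀))
    (ν₀ + n)

/-! ### Assumptions on the models and the estimators -/

/-- `Y_n = O_p(a_n)`: for every `ε > 0` there is a constant `M` such that
`P(|Y_n| > M a_n) ≤ ε` for all sufficiently large `n`. -/
def IsBigOInProbability {Ω : Type*} [MeasurableSpace Ω] (P : Measure Ω) (Y : ℕ → Ω → ℝ)
    (a : ℕ → ℝ) : Prop :=
  ∀ ε : ℝ≥0∞, 0 < ε → ∃ M : ℝ, ∀ᶠ n in atTop, P {ω | M * a n < |Y n ω|} ≤ ε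

/-- `θ` minimizes the expected loss `E ℓ(X; θ)`, `X ∼ P₀`, over the parameter set `Θ`. The
comparison is with all parameters whose expected loss is finite. -/
def IsRiskMinimizer {𝒳 E : Type*} [MeasurableSpace 𝒳] (P₀ : Measure 𝒳) (Θ : Set E)
    (ℓ : 𝒳 → E → ℝ) (θ : E) : Prop :=
  θ ∈ Θ ∧ Integrable (fun x => ℓ x θ) P₀ ∧
    ∀ θ' ∈ Θ, Integrable (fun x => ℓ x θ') P₀ → ∫ x, ℓ x θ ∂P₀ ≤ ∫ x, ℓ x θ' ∂P₀

/-- The regularity condition on one model with parameter set `Θ ⊆ ℝ^d`, loss `ℓ` (only its values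
on `𝒳 × Θ` matter), optimal parameter `θs` and estimators `θh n` based on `n` observations, where
the observations `X i` are distributed according to `P₀`.

The norm of the second derivative is the operator norm of the bilinear form; it is equivalent to
the Frobenius norm of the Hessian matrix, and the constant can be absorbed in `H`. -/
structure RegularModel {Ω 𝒳 : Type*} [MeasurableSpace Ω] [MeasurableSpace 𝒳] (P : Measure Ω)
    (X : ℕ → Ω → 𝒳) (P₀ : Measure 𝒳) {d : ℕ} (Θ : Set (EuclideanSpace ℝ (Fin d)))
    (ℓ : 𝒳 → EuclideanSpace ℝ (Fin d) → ℝ) (θs : EuclideanSpace ℝ (Fin d))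
    (θh : (n : ℕ) → (Fin n → 𝒳) → EuclideanSpace ℝ (Fin d)) : Prop where
  isOpen : IsOpen Θ
  measurable_loss : Measurable fun p : 𝒳 × Θ => ℓ p.1 p.2
  isRiskMinimizer : IsRiskMinimizer P₀ Θ ℓ θs
  regular : ∃ r > 0, Metric.ball θs r ⊆ Θ ∧
    (∀ θ ∈ Metric.ball θs r, Integrable (fun x => ℓ x θ) P₀) ∧
    (∀ x, ContDiffOn ℝ 2 (ℓ x) (Metric.ball θs r)) ∧
    ∃ H : 𝒳 → ℝ, (∀ x, ∀ θ ∈ Metric.ball θs r, ‖iteratedFDeriv ℝ 2 (ℓ x) θ‖ ≤ H x) ∧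
      Integrable H P₀
  integrable_gradient_sq : Integrable (fun x => ‖gradient (ℓ x) θs‖ ^ 2) P₀
  estimator_mem : ∀ n x, θh n x ∈ Θ
  measurable_estimator : ∀ n, Measurable (θh n)
  estimator_rate : IsBigOInProbability P
    (fun n ω => ‖θh n (fun i => X i ω) - θs‖) (fun n => 1 / Real.sqrt n)

/-- The vector `μ⁰` of optimal expected losses, `μ⁰_k = E ℓ_k(X; θ*_k)`. -/
def trueMean {𝒳 : Type*} [MeasurableSpace 𝒳] (P₀ : Measure 𝒳) {K : ℕ} {d : Fin K → ℕ}
    (ℓ : (k : Fin K) → 𝒳 → EuclideanSpace ℝ (Fin (d k)) → ℝ)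
    (θs : (k : Fin K) → EuclideanSpace ℝ (Fin (d k))) : Fin K → ℝ :=
  fun k => ∫ x, ℓ k x (θs k) ∂P₀

/-- The covariance matrix `Σ⁰` of the vector of losses `ℓ_k(X; θ*_k)`. -/
def trueCov {𝒳 : Type*} [MeasurableSpace 𝒳] (P₀ : Measure 𝒳) {K : ℕ} {d : Fin K → ℕ}
    (ℓ : (k : Fin K) → 𝒳 → EuclideanSpace ℝ (Fin (d k)) → ℝ)
    (θs : (k : Fin K) → EuclideanSpace ℝ (Fin (d k))) : Matrix (Fin K) (Fin K) ℝ :=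
  Matrix.of fun j k => covariance (fun x => ℓ j x (θs j)) (fun x => ℓ k x (θs k)) P₀

/-- The data vectors `Z_{ik} = ℓ_k(x_i; θ̂_k(x_1, …, x_n))`. -/
def lossData {𝒳 : Type*} {K : ℕ} {d : Fin K → ℕ}
    (ℓ : (k : Fin K) → 𝒳 → EuclideanSpace ℝ (Fin (d k)) → ℝ)
    (θh : (k : Fin K) → (n : ℕ) → (Fin n → 𝒳) → EuclideanSpace ℝ (Fin (d k)))
    {n : ℕ} (x : Fin n → 𝒳) : Fin n → Fin K → ℝ :=
  fun i k => ℓ k (x i) (θh k n x)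

end LaD

end

/-! The minimal complexity is locally constant at `μ⁰`: since `δ` differs from every gap `μ⁰_k -
min_j μ⁰_j`, each inequality deciding membership in the `δ`-optimal set is strict and survives small
perturbations (`exists_minComplexity_eq`). It therefore suffices that the posterior of the mean
concentrates at `μ⁰`.

Data side: with `η = ‖θ̂ - θ*‖`, Taylor's formula bounds the change of each loss by `‖∇ℓ‖ η + H η²`.
Squaring and averaging leaves terms of order `η²` and `(√n η²)²`, both negligible when `η =
O_p(1/√n)` (`RegularModel.tendsto_mean_sub_sq`). With the law of large numbers, the mean and
covariance of the `Z_i` thus converge in probability to `μ⁰` and `Σ⁰`.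

Posterior side, deterministic: with high probability `Ψ_n` has entries of order `n` and dominates `p
n I`. Posterior consistency for the covariance is not needed; it is enough that `Σ'` rarely exceeds
`√n`. The inverse-Wishart kernel is at most `D^a (1 + ‖s‖)^(-a)` with `a ≈ n/2`, while its integral
is at least geometrically small in `n`; beyond `√n` the factor `(1 + √n)^(-a)` beats every geometric
constant (`eventually_invWishart_tail_le`). When `‖Σ'‖ ≤ √n`, the conditional variances of `μ'` are
at most `1/√n`, so `μ'` is close to `μ_n`, which tends to `μ⁰`. -/

namespace LaD

open scoped Topology

/-! ### Quadratic forms, traces and determinants of positive definite matrices. -/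

section Matrix

variable {n : Type*} [Fintype n] [DecidableEq n]

theorem mul_dotProduct_le_of_le_eigenvalues {A : Matrix n n ℝ} (hA : A.IsHermitian) {t : ℝ}
    (ht : ∀ i, t ≤ hA.eigenvalues i) (v : n → ℝ) : t * (v ⬝ᵥ v) ≤ v ⬝ᵥ (A *ᵥ v) := by
  have hU : (hA.eigenvectorUnitary : Matrix n n ℝ) * (hA.eigenvectorUnitary : Matrix n n ℝ)ᵀ = 1 := by
    have := Unitary.coe_mul_star_self hA.eigenvectorUnitary
    simpa [Matrix.star_eq_conjTranspose] using this
  have hs := hA.spectral_theorem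
  rw [Unitary.conjStarAlgAut_apply] at hs
  set U : Matrix n n ℝ := (hA.eigenvectorUnitary : Matrix n n ℝ) with hUdef
  have hst : A = U * Matrix.diagonal hA.eigenvalues * Uᵀ := by
    simpa [Matrix.star_eq_conjTranspose, Function.comp_def] using hs
  have h1 : v ⬝ᵥ v = (Uᵀ *ᵥ v) ⬝ᵥ (Uᵀ *ᵥ v) := by
    rw [Matrix.dotProduct_mulVec, Matrix.vecMul_transpose, Matrix.mulVec_mulVec, hU,
      Matrix.one_mulVec]
  have h2 : v ⬝ᵥ (A *ᵥ v) = (Uᵀ *ᵥ v) ⬝ᵥ (Matrix.diagonal hA.eigenvalues *ᵥ (Uᵀ *ᵥ v)) := by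
    conv_lhs => rw [hst]
    rw [← Matrix.mulVec_mulVec, ← Matrix.mulVec_mulVec, Matrix.dotProduct_mulVec,
      Matrix.mulVec_transpose]
  rw [h1, h2]
  simp only [dotProduct, Matrix.mulVec_diagonal, Finset.mul_sum]
  refine Finset.sum_le_sum fun i _ => ?_
  nlinarith [mul_nonneg (sub_nonneg.2 (ht i)) (mul_self_nonneg ((Uᵀ *ᵥ v) i))]

theorem exists_pos_le_eigenvalues {A : Matrix n n ℝ} (hA : A.PosDef) :
    ∃ p > 0, ∀ i, p ≤ hA.1.eigenvalues i := by
  rcases isEmpty_or_nonempty n with h | h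
  · exact ⟨1, one_pos, fun i => isEmptyElim i⟩
  · obtain ⟨i, hi⟩ := Finite.exists_min hA.1.eigenvalues
    exact ⟨_, hA.eigenvalues_pos i, hi⟩

theorem dotProduct_mulVec_le_of_abs_le {n : Type*} [Fintype n] {E : Matrix n n ℝ} {r : ℝ} (hE : ∀ i j, |E i j| ≤ r)
    (v : n → ℝ) : |v ⬝ᵥ (E *ᵥ v)| ≤ r * Fintype.card n * (v ⬝ᵥ v) := by
  have h1 : ∀ i j, |v i * (E i j * v j)| ≤ r * ((v i * v i + v j * v j) / 2) := fun i j => by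
    rw [abs_mul, abs_mul]
    have := two_mul_le_add_sq |v i| |v j|
    rw [sq_abs, sq_abs] at this
    nlinarith [hE i j, mul_nonneg (abs_nonneg (v i)) (abs_nonneg (v j)), abs_nonneg (E i j),
      mul_le_mul_of_nonneg_left (hE i j) (mul_nonneg (abs_nonneg (v i)) (abs_nonneg (v j)))]
  calc |v ⬝ᵥ (E *ᵥ v)| = |∑ i, ∑ j, v i * (E i j * v j)| := by
        simp [dotProduct, Matrix.mulVec, Finset.mul_sum]
    _ ≤ ∑ i, ∑ j, r * ((v i * v i + v j * v j) / 2) :=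
        (Finset.abs_sum_le_sum_abs _ _).trans (Finset.sum_le_sum fun i _ =>
          (Finset.abs_sum_le_sum_abs _ _).trans (Finset.sum_le_sum fun j _ => h1 i j))
    _ = r * Fintype.card n * (v ⬝ᵥ v) := by
        simp only [← Finset.mul_sum, ← Finset.sum_div, Finset.sum_add_distrib, Finset.sum_const,
          dotProduct, Finset.card_univ, nsmul_eq_mul]
        simp only [mul_left_comm (v _), ← Finset.mul_sum]
        ring

/-- A positive definite matrix has a neighbourhood on which the quadratic forms are uniformly
bounded below. -/
theorem eventually_mul_dotProduct_le {A : Matrix n n ℝ} (hA : A.PosDef) :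
    ∃ p > 0, ∀ᶠ B in 𝓝 A, ∀ v, p * (v ⬝ᵥ v) ≤ v ⬝ᵥ (B *ᵥ v) := by
  obtain ⟨p, hp, hpA⟩ := exists_pos_le_eigenvalues hA
  -- A perturbation with entries of this size costs the form at most half of `p`; the `+ 1` keeps
  -- the radius positive for an empty index type.
  have hr : 0 < p / 2 / (Fintype.card n + 1) := by positivity
  refine ⟨p / 2, half_pos hp, ?_⟩
  have hev : ∀ᶠ B in 𝓝 A, ∀ i j, |B i j - A i j| ≤ p / 2 / (Fintype.card n + 1) := by
    rw [eventually_all]; intro i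
    rw [eventually_all]; intro j
    have hc : Tendsto (fun B : Matrix n n ℝ => |B i j - A i j|) (𝓝 A) (𝓝 |A i j - A i j|) :=
      (Continuous.abs ((continuous_id.matrix_elem i j).sub continuous_const)).tendsto A
    rw [sub_self, abs_zero] at hc
    exact hc.eventually_le_const hr
  filter_upwards [hev] with B hB v
  have h1 := mul_dotProduct_le_of_le_eigenvalues hA.1 hpA v
  have h2 := dotProduct_mulVec_le_of_abs_le (E := B - A) hB v
  have hv : 0 ≤ v ⬝ᵥ v := Finset.sum_nonneg fun i _ => mul_self_nonneg _
  have h3 : p / 2 / (Fintype.card n + 1) * Fintype.card n * (v ⬝ᵥ v) ≤ p / 2 * (v ⬝ᵥ v) := by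
    refine mul_le_mul_of_nonneg_right ?_ hv
    rw [div_mul_eq_mul_div, div_le_iff₀ (by positivity)]
    nlinarith
  rw [Matrix.sub_mulVec, dotProduct_sub] at h2
  linarith [neg_abs_le (v ⬝ᵥ (B *ᵥ v) - v ⬝ᵥ (A *ᵥ v))]

theorem posDef_of_mul_dotProduct_le {n : Type*} [Fintype n] {B : Matrix n n ℝ} (hB : B.IsHermitian) {p : ℝ} (hp : 0 < p)
    (h : ∀ v, p * (v ⬝ᵥ v) ≤ v ⬝ᵥ (B *ᵥ v)) : B.PosDef := by
  refine Matrix.PosDef.of_dotProduct_mulVec_pos hB fun x hx => ?_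
  have : 0 < x ⬝ᵥ x := by
    simpa using Matrix.dotProduct_star_self_pos_iff.2 hx
  simpa using (mul_pos hp this).trans_le (h x)

/-- Writing `T = Bᵀ B` turns both traces into sums of quadratic forms over the rows of `B`. -/
theorem mul_trace_le_trace_mul {Ψ T : Matrix n n ℝ} (hT : T.PosSemidef) {p : ℝ}
    (h : ∀ v, p * (v ⬝ᵥ v) ≤ v ⬝ᵥ (Ψ *ᵥ v)) : p * T.trace ≤ (Ψ * T).trace := by
  obtain ⟨B, hB⟩ : ∃ B : Matrix n n ℝ, T = Bᵀ * B := by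
    open scoped MatrixOrder in
    obtain ⟨B, hB⟩ := CStarAlgebra.nonneg_iff_eq_star_mul_self.mp hT.nonneg
    exact ⟨B, by simpa [Matrix.star_eq_conjTranspose] using hB⟩
  have h1 : T.trace = ∑ i, B i ⬝ᵥ B i := by
    rw [hB, Matrix.trace_mul_comm]; rfl
  have h2 : (Ψ * T).trace = ∑ i, B i ⬝ᵥ (Ψ *ᵥ B i) := by
    rw [hB, ← Matrix.mul_assoc, Matrix.trace_mul_comm]; rfl
  rw [h1, h2, Finset.mul_sum]
  exact Finset.sum_le_sum fun i _ => h _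

/-- Cauchy–Schwarz for the inner product of `S⁻¹`, applied to `y` and `w = S e_k`: their product is
`y k`, and `w` has squared norm `S k k`. -/
theorem sq_dotProduct_single_le {S : Matrix n n ℝ} (hS : S.PosDef) (y : n → ℝ) (k : n) :
    y k ^ 2 ≤ S k k * (y ⬝ᵥ (S⁻¹ *ᵥ y)) := by
  have hu : IsUnit S.det := by simpa using hS.det_pos.ne'
  have hT : S⁻¹.PosDef := hS.inv
  have hkk : 0 < S k k := hS.diag_pos
  set w : n → ℝ := S *ᵥ Pi.single k 1 with hw
  have hSw : S⁻¹ *ᵥ w = Pi.single k 1 := by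
    rw [hw, Matrix.mulVec_mulVec, Matrix.nonsing_inv_mul _ hu, Matrix.one_mulVec]
  have hwk : w k = S k k := by simp [hw]
  have hsym : w ⬝ᵥ (S⁻¹ *ᵥ y) = y k := by
    rw [Matrix.dotProduct_mulVec, ← Matrix.mulVec_transpose]
    have : (S⁻¹)ᵀ = S⁻¹ := by simpa using hT.1.eq
    rw [this, hSw]; simp
  have hpos := hT.posSemidef.dotProduct_mulVec_nonneg (S k k • y - y k • w)
  simp only [star_trivial, Matrix.mulVec_sub, Matrix.mulVec_smul, hSw, sub_dotProduct,
    dotProduct_sub, smul_dotProduct, dotProduct_smul, smul_eq_mul, hsym,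
    dotProduct_single, mul_one, Pi.sub_apply, Pi.smul_apply, hwk] at hpos
  have : 0 ≤ S k k * (S k k * (y ⬝ᵥ (S⁻¹ *ᵥ y)) - y k ^ 2) := by nlinarith
  nlinarith [(mul_nonneg_iff_of_pos_left hkk).1 this]

/-- Testing the hypothesis on `S e_j` gives `t ∑ᵢ S i j ^ 2 ≤ S j j`. The diagonal term yields `t *
S j j ≤ 1`, and then any other term yields the claim. -/
theorem abs_apply_mul_le_one {S : Matrix n n ℝ} (hS : S.PosDef) {t : ℝ} (ht : 0 ≤ t)
    (h : ∀ v, t * (v ⬝ᵥ v) ≤ v ⬝ᵥ (S⁻¹ *ᵥ v)) (i j : n) : |S i j| * t ≤ 1 := by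
  have hu : IsUnit S.det := by simpa using hS.det_pos.ne'
  have h1 := h (S *ᵥ Pi.single j 1)
  rw [Matrix.mulVec_mulVec, Matrix.nonsing_inv_mul _ hu, Matrix.one_mulVec] at h1
  have hle : ∀ i, t * (S i j) ^ 2 ≤ S j j := fun i => by
    refine le_trans ?_ (h1.trans_eq (by simp))
    refine mul_le_mul_of_nonneg_left ?_ ht
    rw [dotProduct]
    refine le_trans (by simp [sq]) (Finset.single_le_sum (f := fun i =>
      (S *ᵥ Pi.single j 1) i * (S *ᵥ Pi.single j 1) i) (fun i _ => mul_self_nonneg _)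
      (Finset.mem_univ i))
  have hjj : 0 < S j j := hS.diag_pos
  have hj : t * S j j ≤ 1 := by nlinarith [hle j]
  have : (|S i j| * t) ^ 2 ≤ 1 := by
    rw [mul_pow, sq_abs]
    nlinarith [hle i]
  nlinarith [mul_nonneg (abs_nonneg (S i j)) ht]

/-- This is `u e^(-u) ≤ 1` at `u = P t / (2 a)`, raised to the power `a`. -/
theorem rpow_mul_exp_le {a P t : ℝ} (ha : 0 < a) (hP : 0 < P) (ht : 0 ≤ t) :
    t ^ a * Real.exp (-(1 / 2) * (P * t)) ≤ (2 * a / P) ^ a := by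
  have hu : (P * t / (2 * a)) * Real.exp (-(P * t / (2 * a))) ≤ 1 := by
    rw [Real.exp_neg, ← div_eq_mul_inv, div_le_one (Real.exp_pos _)]
    linarith [Real.add_one_le_exp (P * t / (2 * a))]
  have h2 : t * Real.exp (-(P * t / (2 * a))) ≤ 2 * a / P := by
    calc t * Real.exp (-(P * t / (2 * a)))
        = (2 * a / P) * ((P * t / (2 * a)) * Real.exp (-(P * t / (2 * a)))) := by
          field_simp
      _ ≤ (2 * a / P) * 1 := mul_le_mul_of_nonneg_left hu (by positivity)
      _ = _ := mul_one _
  calc t ^ a * Real.exp (-(1 / 2) * (P * t))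
      = (t * Real.exp (-(P * t / (2 * a)))) ^ a := by
        rw [Real.mul_rpow ht (Real.exp_pos _).le, ← Real.exp_mul]
        congr 2; field_simp
    _ ≤ _ := Real.rpow_le_rpow (by positivity) h2 ha.le

/-- Bound of the inverse-Wishart kernel by a power of the size of the matrix. -/
theorem det_rpow_mul_exp_le {S Ψ : Matrix n n ℝ} (hS : S.PosDef) {a P B : ℝ} (ha : 0 < a)
    (hP : 0 < P) (hB : 1 ≤ B) (haP : 2 * a / P ≤ B) (h : ∀ v, P * (v ⬝ᵥ v) ≤ v ⬝ᵥ (Ψ *ᵥ v))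
    (i j : n) :
    S.det ^ (-a) * Real.exp (-(1 / 2) * (Ψ * S⁻¹).trace) * (1 + |S i j|) ^ a
      ≤ (2 * B ^ (Fintype.card n)) ^ a := by
  have hB0 : 0 < B := one_pos.trans_le hB
  have hT := hS.inv
  set τ := hT.1.eigenvalues with hτ
  have hτpos : ∀ i, 0 < τ i := hT.eigenvalues_pos
  have hdet : S.det ^ (-a) = ∏ i, τ i ^ a := by
    have : (S⁻¹).det = ∏ i, τ i := by simpa using hT.1.det_eq_prod_eigenvalues
    rw [Matrix.det_nonsing_inv, Ring.inverse_eq_inv'] at this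
    rw [Real.rpow_neg hS.det_pos.le, ← Real.inv_rpow hS.det_pos.le, this,
      Real.finsetProd_rpow _ _ fun i _ => (hτpos i).le]
  have htr : Real.exp (-(1 / 2) * (Ψ * S⁻¹).trace) ≤ ∏ i, Real.exp (-(1 / 2) * (P * τ i)) := by
    rw [← Real.exp_sum, ← Finset.mul_sum, ← Finset.mul_sum]
    have h1 : (S⁻¹).trace = ∑ i, τ i := by simpa using hT.1.trace_eq_sum_eigenvalues
    have := mul_trace_le_trace_mul hT.posSemidef h
    rw [h1] at this
    exact Real.exp_le_exp.2 (by linarith)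
  have : Nonempty n := ⟨i⟩
  obtain ⟨m, hm⟩ := Finite.exists_min τ
  have hsmall : |S i j| * τ m ≤ 1 := abs_apply_mul_le_one hS (hτpos m).le
    (mul_dotProduct_le_of_le_eigenvalues hT.1 hm) i j
  -- The kernel is dominated by a product over the eigenvalues of `S⁻¹`, each factor being at most
  -- `B ^ a`.
  set g : n → ℝ := fun i => τ i ^ a * Real.exp (-(1 / 2) * (P * τ i)) with hg
  have hg0 : ∀ i, 0 ≤ g i := fun i => mul_nonneg (Real.rpow_nonneg (hτpos i).le _) (Real.exp_pos _).le
  have hgB : ∀ i, g i ≤ B ^ a := fun i => (rpow_mul_exp_le ha hP (hτpos i).le).trans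
    (Real.rpow_le_rpow (by positivity) haP ha.le)
  have hBa : 1 ≤ B ^ a := Real.one_le_rpow hB ha.le
  -- A large entry of `S` forces the smallest eigenvalue of `S⁻¹` below `1 / |S i j|`, so this
  -- single factor absorbs the whole weight.
  have hgm : g m * (1 + |S i j|) ^ a ≤ (2 * B) ^ a := by
    have hb : (1 + |S i j|) ^ a ≤ 2 ^ a * max 1 (|S i j| ^ a) := by
      rcases le_total (|S i j|) 1 with h1 | h1
      · calc (1 + |S i j|) ^ a ≤ 2 ^ a := Real.rpow_le_rpow (by positivity) (by linarith) ha.le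
          _ ≤ 2 ^ a * max 1 (|S i j| ^ a) := le_mul_of_one_le_right (by positivity) (le_max_left _ _)
      · calc (1 + |S i j|) ^ a ≤ (2 * |S i j|) ^ a :=
              Real.rpow_le_rpow (by positivity) (by linarith) ha.le
          _ = 2 ^ a * |S i j| ^ a := Real.mul_rpow (by positivity) (by positivity)
          _ ≤ 2 ^ a * max 1 (|S i j| ^ a) := by gcongr; exact le_max_right _ _
    refine (mul_le_mul_of_nonneg_left hb (hg0 m)).trans ?_
    rw [Real.mul_rpow (by norm_num) hB0.le, mul_left_comm]
    refine mul_le_mul_of_nonneg_left ?_ (by positivity)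
    rw [mul_max_of_nonneg _ _ (hg0 m), mul_one]
    refine max_le (hgB m) ?_
    calc g m * |S i j| ^ a = (|S i j| * τ m) ^ a * Real.exp (-(1 / 2) * (P * τ m)) := by
          rw [Real.mul_rpow (abs_nonneg _) (hτpos m).le]; simp only [hg]; ring
      _ ≤ 1 * 1 := by
          refine mul_le_mul (Real.rpow_le_one ?_ hsmall ha.le) ?_ (Real.exp_pos _).le one_pos.le
          · exact mul_nonneg (abs_nonneg _) (hτpos m).le
          · rw [Real.exp_le_one_iff]; nlinarith [mul_pos hP (hτpos m)]
      _ ≤ B ^ a := by simpa using hBa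
  have hrest : ∏ i ∈ Finset.univ.erase m, g i ≤ (B ^ a) ^ (Fintype.card n - 1) := by
    refine (Finset.prod_le_prod (fun i _ => hg0 i) fun i _ => hgB i).trans_eq ?_
    rw [Finset.prod_const, Finset.card_erase_of_mem (Finset.mem_univ _), Finset.card_univ]
  calc S.det ^ (-a) * Real.exp (-(1 / 2) * (Ψ * S⁻¹).trace) * (1 + |S i j|) ^ a
      ≤ (∏ i, g i) * (1 + |S i j|) ^ a := by
        refine mul_le_mul_of_nonneg_right ?_ (by positivity)
        rw [hdet, hg, Finset.prod_mul_distrib]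
        exact mul_le_mul_of_nonneg_left htr
          (Finset.prod_nonneg fun i _ => Real.rpow_nonneg (hτpos i).le _)
    _ = (∏ i ∈ Finset.univ.erase m, g i) * (g m * (1 + |S i j|) ^ a) := by
        rw [← Finset.prod_erase_mul _ _ (Finset.mem_univ m), mul_assoc]
    _ ≤ (B ^ a) ^ (Fintype.card n - 1) * (2 * B) ^ a :=
        mul_le_mul hrest hgm (mul_nonneg (hg0 m) (by positivity)) (by positivity)
    _ = (2 * B ^ (Fintype.card n)) ^ a := by
        rw [Real.mul_rpow (by norm_num) hB0.le, Real.mul_rpow (by norm_num) (by positivity),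
          ← Real.rpow_natCast B, ← Real.rpow_mul hB0.le, mul_comm _ a, Real.rpow_mul hB0.le,
          Real.rpow_natCast, mul_left_comm, ← pow_succ, Nat.sub_add_cancel Fintype.card_pos]

end Matrix

/-! ### Total mass and tails of the multivariate Gaussian density. -/

section Gaussian

variable {K : ℕ}

theorem measurable_gaussianDensity (m : Fin K → ℝ) (S : Matrix (Fin K) (Fin K) ℝ) :
    Measurable (gaussianDensity m S) := by
  have : Continuous fun x : Fin K → ℝ => (x - m) ⬝ᵥ (S⁻¹ *ᵥ (x - m)) := by fun_prop
  unfold gaussianDensity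
  fun_prop

theorem lintegral_prod_gaussian :
    ∫⁻ x : Fin K → ℝ, ENNReal.ofReal (Real.exp (-(1 / 2) * (x ⬝ᵥ x)))
      = ENNReal.ofReal ((2 * Real.pi) ^ ((K : ℝ) / 2)) := by
  have hint : Integrable fun t : ℝ => Real.exp (-(1 / 2) * t ^ 2) :=
    integrable_exp_neg_mul_sq (by norm_num)
  have hfun : (fun x : Fin K → ℝ => Real.exp (-(1 / 2) * (x ⬝ᵥ x)))
      = fun x => ∏ i, Real.exp (-(1 / 2) * (x i) ^ 2) := by
    funext x
    rw [← Real.exp_sum, ← Finset.mul_sum]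
    simp [dotProduct, sq]
  have hI : Integrable (fun x : Fin K → ℝ => Real.exp (-(1 / 2) * (x ⬝ᵥ x))) := by
    rw [hfun]
    exact Integrable.fintype_prod (f := fun _ t => Real.exp (-(1 / 2) * t ^ 2)) fun _ => hint
  rw [← ofReal_integral_eq_lintegral_ofReal hI (.of_forall fun x => (Real.exp_pos _).le), hfun]
  congr 1
  have h1 := MeasureTheory.integral_fintype_prod_volume_eq_pow (ι := Fin K) (E := ℝ)
    (fun t : ℝ => Real.exp (-(1 / 2) * t ^ 2))
  rw [h1, integral_gaussian, Real.sqrt_eq_rpow, ← Real.rpow_natCast, ← Real.rpow_mul (by positivity)]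
  simp only [Fintype.card_fin]
  congr 1 <;> ring

/-- The Gaussian density with positive definite covariance has total mass one. -/
theorem lintegral_gaussianDensity (m : Fin K → ℝ) {S : Matrix (Fin K) (Fin K) ℝ} (hS : S.PosDef) :
    ∫⁻ x, ENNReal.ofReal (gaussianDensity m S x) = 1 := by
  obtain ⟨B, hB⟩ : ∃ B : Matrix (Fin K) (Fin K) ℝ, S⁻¹ = Bᵀ * B := by
    open scoped MatrixOrder in
    obtain ⟨B, hB⟩ := CStarAlgebra.nonneg_iff_eq_star_mul_self.mp hS.inv.posSemidef.nonneg
    exact ⟨B, by simpa [Matrix.star_eq_conjTranspose] using hB⟩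
  have hdetS : S.det⁻¹ = B.det ^ 2 := by
    have := congrArg Matrix.det hB
    rw [Matrix.det_nonsing_inv, Ring.inverse_eq_inv', Matrix.det_mul, Matrix.det_transpose] at this
    rw [this, sq]
  have hB0 : B.det ≠ 0 := fun h => by
    rw [h] at hdetS
    exact (inv_pos.2 hS.det_pos).ne' (by simpa using hdetS)
  have hpi := Real.pi_pos
  have hdet : S.det ^ (-(1 / 2) : ℝ) = |B.det| := by
    rw [Real.rpow_neg hS.det_pos.le, ← Real.inv_rpow hS.det_pos.le, hdetS, ← Real.sqrt_eq_rpow,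
      Real.sqrt_sq_eq_abs]
  have hquad : ∀ x : Fin K → ℝ, x ⬝ᵥ (S⁻¹ *ᵥ x) = (B *ᵥ x) ⬝ᵥ (B *ᵥ x) := fun x => by
    rw [hB, ← Matrix.mulVec_mulVec, Matrix.dotProduct_mulVec, Matrix.vecMul_transpose]
  -- With `S⁻¹ = Bᵀ B`, the substitution by `B` reduces to the standard Gaussian; its Jacobian
  -- cancels `|det B| = (det S) ^ (-1/2)`.
  have hmap := Real.map_matrix_volume_pi_eq_smul_volume_pi hB0
  have hmeas : Measurable fun x : Fin K → ℝ => ENNReal.ofReal (Real.exp (-(1 / 2) * (x ⬝ᵥ x))) := by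
    have : Continuous fun x : Fin K → ℝ => x ⬝ᵥ x := by fun_prop
    fun_prop
  have hBm : Measurable fun x : Fin K → ℝ => Matrix.toLin' B x :=
    (LinearMap.continuous_on_pi _).measurable
  have hcv : ∫⁻ x : Fin K → ℝ, ENNReal.ofReal (Real.exp (-(1 / 2) * ((B *ᵥ x) ⬝ᵥ (B *ᵥ x))))
      = ENNReal.ofReal |B.det⁻¹| * ENNReal.ofReal ((2 * Real.pi) ^ ((K : ℝ) / 2)) := by
    rw [← lintegral_prod_gaussian, ← smul_eq_mul, ← lintegral_smul_measure, ← hmap,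
      lintegral_map hmeas hBm]
    simp
  calc ∫⁻ x, ENNReal.ofReal (gaussianDensity m S x)
      = ∫⁻ x, ENNReal.ofReal (gaussianDensity 0 S x) := by
        rw [← lintegral_sub_right_eq_self (fun x => ENNReal.ofReal (gaussianDensity 0 S x)) m]
        simp only [gaussianDensity, sub_zero]
    _ = ENNReal.ofReal ((2 * Real.pi) ^ (-(K : ℝ) / 2) * |B.det|) *
          ∫⁻ x : Fin K → ℝ, ENNReal.ofReal (Real.exp (-(1 / 2) * ((B *ᵥ x) ⬝ᵥ (B *ᵥ x)))) := by
        rw [← lintegral_const_mul' _ _ ENNReal.ofReal_ne_top]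
        refine lintegral_congr fun x => ?_
        rw [← ENNReal.ofReal_mul (by positivity), gaussianDensity, sub_zero, hquad, hdet]
    _ = 1 := by
        rw [hcv, ← ENNReal.ofReal_mul (by positivity), ← ENNReal.ofReal_mul (by positivity),
          ← ENNReal.ofReal_one, abs_inv, neg_div, Real.rpow_neg (by positivity)]
        congr 1
        have := abs_pos.2 hB0
        have : 0 < (2 * Real.pi) ^ ((K : ℝ) / 2) := by positivity
        field_simp

/-- A one-coordinate tail bound for the Gaussian distribution. -/
theorem setLIntegral_gaussianDensity_le (m : Fin K → ℝ) {S : Matrix (Fin K) (Fin K) ℝ}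
    (hS : S.PosDef) (k : Fin K) {e b : ℝ} (he : 0 ≤ e) (hb : S k k ≤ b) :
    ∫⁻ x in {x | e ≤ |x k - m k|}, ENNReal.ofReal (gaussianDensity m S x)
      ≤ ENNReal.ofReal (2 ^ ((K : ℝ) / 2) * Real.exp (-(e ^ 2 / (4 * b)))) := by
  have h2S : ((2 : ℝ) • S).PosDef := hS.smul two_pos
  have hkk : 0 < S k k := hS.diag_pos
  have hinv : ((2 : ℝ) • S)⁻¹ = (2 : ℝ)⁻¹ • S⁻¹ := by
    refine Matrix.inv_eq_left_inv ?_
    rw [Matrix.smul_mul, Matrix.mul_smul, smul_smul,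
      Matrix.nonsing_inv_mul _ (by simpa using hS.det_pos.ne')]
    simp
  have hpi := Real.pi_pos
  -- Half of the exponent `q / 2` pays for the tail, since `q ≥ e² / b`; the other half is the
  -- exponent of `N(m, 2S)`, and `2 ^ (K / 2)` is the resulting determinant ratio.
  have hpt : ∀ x ∈ {x : Fin K → ℝ | e ≤ |x k - m k|}, gaussianDensity m S x ≤
      2 ^ ((K : ℝ) / 2) * Real.exp (-(e ^ 2 / (4 * b))) * gaussianDensity m ((2 : ℝ) • S) x := by
    intro x hx
    have hq := sq_dotProduct_single_le hS (x - m) k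
    set q := (x - m) ⬝ᵥ (S⁻¹ *ᵥ (x - m)) with hqd
    have he2 : e ^ 2 ≤ S k k * q := by
      refine le_trans ?_ hq
      rw [← sq_abs ((x - m) k)]
      exact pow_le_pow_left₀ he hx 2
    have hq0 : 0 ≤ q := by nlinarith [sq_nonneg ((x - m) k)]
    have hqe : e ^ 2 / (4 * b) ≤ q / 4 := by
      rw [div_le_iff₀ (by linarith)]
      nlinarith
    have hdet : ((2 : ℝ) • S).det ^ (-(1 / 2) : ℝ) = 2 ^ (-((K : ℝ) / 2)) * S.det ^ (-(1 / 2) : ℝ) := by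
      rw [Matrix.det_smul, Fintype.card_fin, Real.mul_rpow (by positivity) hS.det_pos.le,
        ← Real.rpow_natCast, ← Real.rpow_mul two_pos.le]
      congr 2; ring
    have h2 : (2 : ℝ) ^ ((K : ℝ) / 2) * 2 ^ (-((K : ℝ) / 2)) = 1 := by
      rw [← Real.rpow_add two_pos]; simp
    have hc : 0 ≤ (2 * Real.pi) ^ (-(K : ℝ) / 2) * S.det ^ (-(1 / 2) : ℝ) :=
      mul_nonneg (by positivity) (Real.rpow_nonneg hS.det_pos.le _)
    calc gaussianDensity m S x
        = (2 * Real.pi) ^ (-(K : ℝ) / 2) * S.det ^ (-(1 / 2) : ℝ) * Real.exp (-(1 / 2) * q) := rfl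
      _ ≤ (2 * Real.pi) ^ (-(K : ℝ) / 2) * S.det ^ (-(1 / 2) : ℝ) *
            (Real.exp (-(e ^ 2 / (4 * b))) * Real.exp (-(1 / 2) * (2⁻¹ * q))) := by
          refine mul_le_mul_of_nonneg_left ?_ hc
          rw [← Real.exp_add]
          exact Real.exp_le_exp.2 (by linarith)
      _ = ((2 : ℝ) ^ ((K : ℝ) / 2) * 2 ^ (-((K : ℝ) / 2))) *
            ((2 * Real.pi) ^ (-(K : ℝ) / 2) * S.det ^ (-(1 / 2) : ℝ) *
            (Real.exp (-(e ^ 2 / (4 * b))) * Real.exp (-(1 / 2) * (2⁻¹ * q)))) := by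
          rw [h2, one_mul]
      _ = _ := by
          rw [gaussianDensity, hinv, hdet, Matrix.smul_mulVec, dotProduct_smul, smul_eq_mul, ← hqd]
          ring
  calc ∫⁻ x in {x | e ≤ |x k - m k|}, ENNReal.ofReal (gaussianDensity m S x)
      ≤ ∫⁻ x in {x | e ≤ |x k - m k|}, ENNReal.ofReal (2 ^ ((K : ℝ) / 2) *
          Real.exp (-(e ^ 2 / (4 * b)))) * ENNReal.ofReal (gaussianDensity m ((2 : ℝ) • S) x) := by
        refine setLIntegral_mono' ?_ fun x hx => ?_
        · exact measurableSet_le measurable_const (by fun_prop)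
        · rw [← ENNReal.ofReal_mul (by positivity)]
          exact ENNReal.ofReal_le_ofReal (hpt x hx)
    _ ≤ ∫⁻ x, ENNReal.ofReal (2 ^ ((K : ℝ) / 2) *
          Real.exp (-(e ^ 2 / (4 * b)))) * ENNReal.ofReal (gaussianDensity m ((2 : ℝ) • S) x) :=
        setLIntegral_le_lintegral _ _
    _ = _ := by
        rw [lintegral_const_mul' _ _ ENNReal.ofReal_ne_top, lintegral_gaussianDensity m h2S, mul_one]

end Gaussian

/-! ### Measurability and two-sided bounds for the inverse-Wishart kernel. -/

section InverseWishart

variable {K : ℕ}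

theorem continuous_symMatrix : Continuous (symMatrix : SymEntries K → Matrix (Fin K) (Fin K) ℝ) :=
  continuous_matrix fun i j => continuous_apply s(i, j)

theorem isHermitian_symMatrix (s : SymEntries K) : (symMatrix s).IsHermitian := by
  ext i j
  simp [symMatrix, Sym2.eq_swap]

theorem isOpen_posDef_symMatrix : IsOpen {s : SymEntries K | (symMatrix s).PosDef} := by
  refine isOpen_iff_mem_nhds.2 fun s hs => ?_
  obtain ⟨p, hp, h⟩ := eventually_mul_dotProduct_le hs
  filter_upwards [continuous_symMatrix.continuousAt.eventually h] with t ht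
  exact posDef_of_mul_dotProduct_le (isHermitian_symMatrix t) hp ht

theorem measurable_det_symMatrix : Measurable fun s : SymEntries K => (symMatrix s).det :=
  continuous_symMatrix.matrix_det.measurable

theorem measurable_inv_symMatrix_apply (i j : Fin K) :
    Measurable fun s : SymEntries K => (symMatrix s)⁻¹ i j := by
  simp only [Matrix.inv_def, Ring.inverse_eq_inv', Matrix.smul_apply, smul_eq_mul]
  exact measurable_det_symMatrix.inv.mul
    (continuous_symMatrix.matrix_adjugate.matrix_elem i j).measurable

theorem measurable_invWishartKernel (Ψ : Matrix (Fin K) (Fin K) ℝ) (ν : ℝ) :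
    Measurable (invWishartKernel Ψ ν) := by
  refine Measurable.ite isOpen_posDef_symMatrix.measurableSet ?_ measurable_const
  have h1 : Measurable fun s : SymEntries K => (Ψ * (symMatrix s)⁻¹).trace := by
    simp only [Matrix.trace, Matrix.diag, Matrix.mul_apply]
    exact Finset.measurable_fun_sum _ fun i _ => Finset.measurable_fun_sum _ fun j _ =>
      (measurable_inv_symMatrix_apply j i).const_mul _
  have h2 := measurable_det_symMatrix (K := K)
  fun_prop

theorem measurable_invWishartDensity (Ψ : Matrix (Fin K) (Fin K) ℝ) (ν : ℝ) :
    Measurable (invWishartDensity Ψ ν) :=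
  (measurable_invWishartKernel Ψ ν).div_const _

theorem measurable_gaussianDensity_symMatrix (m : Fin K → ℝ) (l : ℝ) :
    Measurable fun p : (Fin K → ℝ) × SymEntries K =>
      gaussianDensity m (l⁻¹ • symMatrix p.2) p.1 := by
  have hsc : Measurable fun p : (Fin K → ℝ) × SymEntries K => l⁻¹ • p.2 := by fun_prop
  have hd : Measurable fun p : (Fin K → ℝ) × SymEntries K => (l⁻¹ • symMatrix p.2).det :=
    measurable_det_symMatrix.comp hsc
  have hi : ∀ i j, Measurable fun p : (Fin K → ℝ) × SymEntries K =>
      (l⁻¹ • symMatrix p.2)⁻¹ i j := fun i j => (measurable_inv_symMatrix_apply i j).comp hsc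
  have hx : ∀ i, Measurable fun p : (Fin K → ℝ) × SymEntries K => p.1 i - m i := fun i => by
    fun_prop
  have hq : Measurable fun p : (Fin K → ℝ) × SymEntries K =>
      (p.1 - m) ⬝ᵥ ((l⁻¹ • symMatrix p.2)⁻¹ *ᵥ (p.1 - m)) := by
    simp only [dotProduct, Matrix.mulVec, Pi.sub_apply]
    exact Finset.measurable_fun_sum _ fun i _ => (hx i).mul <|
      Finset.measurable_fun_sum _ fun j _ => (hi i j).mul (hx j)
  unfold gaussianDensity
  exact ((hd.pow_const _).const_mul _).mul (hq.const_mul _).exp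

/-- Tonelli: the first marginal is a mixture of Gaussians over the covariance. -/
theorem normalInvWishart_preimage_fst (m : Fin K → ℝ) (l : ℝ) (Ψ : Matrix (Fin K) (Fin K) ℝ)
    (ν : ℝ) {A : Set (Fin K → ℝ)} (hA : MeasurableSet A) :
    normalInvWishart m l Ψ ν (Prod.fst ⁻¹' A) = ∫⁻ s, invWishartDensity Ψ ν s *
      ∫⁻ x in A, ENNReal.ofReal (gaussianDensity m (l⁻¹ • symMatrix s) x) := by
  have hm : Measurable fun p : (Fin K → ℝ) × SymEntries K =>
      ENNReal.ofReal (gaussianDensity m (l⁻¹ • symMatrix p.2) p.1) * invWishartDensity Ψ ν p.2 :=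
    (measurable_gaussianDensity_symMatrix m l).ennreal_ofReal.mul
      ((measurable_invWishartDensity Ψ ν).comp measurable_snd)
  rw [normalInvWishart, withDensity_apply _ (measurable_fst hA), ← Set.prod_univ,
    Measure.volume_eq_prod, ← Measure.prod_restrict, Measure.restrict_univ,
    lintegral_prod_symm' _ hm]
  refine lintegral_congr fun s => ?_
  rw [mul_comm, ← lintegral_mul_const _ (measurable_gaussianDensity _ _).ennreal_ofReal]

/-- `det_rpow_mul_exp_le` at the entry attaining the sup norm. The constant is a power with the same
exponent as the decay, so it can be beaten once `‖s‖` is large. -/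
theorem invWishartKernel_le [NeZero K] {Ψ : Matrix (Fin K) (Fin K) ℝ} {ν P B : ℝ}
    (hν : 0 < ν + K + 1) (hP : 0 < P) (hB : 1 ≤ B) (hνP : (ν + K + 1) / P ≤ B)
    (h : ∀ v, P * (v ⬝ᵥ v) ≤ v ⬝ᵥ (Ψ *ᵥ v)) (s : SymEntries K) :
    invWishartKernel Ψ ν s ≤ ENNReal.ofReal
      ((2 * B ^ K) ^ ((ν + K + 1) / 2) * (1 + ‖s‖) ^ (-((ν + K + 1) / 2))) := by
  unfold invWishartKernel
  split_ifs with hs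
  · refine ENNReal.ofReal_le_ofReal ?_
    set a := (ν + K + 1) / 2 with ha
    have ha0 : 0 < a := by positivity
    have : Nonempty (Sym2 (Fin K)) := ⟨s(0, 0)⟩
    obtain ⟨z, hz⟩ := Finite.exists_max fun z => ‖s z‖
    have hsz : ‖s‖ ≤ ‖s z‖ := (pi_norm_le_iff_of_nonneg (norm_nonneg _)).2 hz
    induction z using Sym2.ind with
    | _ i j =>
      have key := det_rpow_mul_exp_le hs (a := a) ha0 hP hB
        (by rw [ha]; convert hνP using 2; ring) h i j
      rw [Fintype.card_fin] at key
      rw [neg_div, ← ha, Real.rpow_neg (x := 1 + ‖s‖) (by positivity),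
        ← div_eq_mul_inv ((2 * B ^ K) ^ a),
        le_div_iff₀ (by positivity)]
      refine le_trans (mul_le_mul_of_nonneg_left ?_ ?_) key
      · refine Real.rpow_le_rpow (by positivity) ?_ ha0.le
        have : |symMatrix s i j| = ‖s s(i, j)‖ := rfl
        linarith
      · exact mul_nonneg (Real.rpow_nonneg hs.det_pos.le _) (Real.exp_pos _).le
  · exact zero_le

theorem symMatrix_isDiag :
    symMatrix (fun z : Sym2 (Fin K) => open Classical in if z.IsDiag then (1 : ℝ) else 0) = 1 := by
  ext i j
  simp [symMatrix, Matrix.one_apply]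

/-- A lower bound for the normalizing constant of the inverse-Wishart distribution. -/
theorem exists_le_lintegral_invWishartKernel (K : ℕ) :
    ∃ u : ℝ≥0∞, u ≠ 0 ∧ ∀ (Ψ : Matrix (Fin K) (Fin K) ℝ) (ν L : ℝ), 0 < ν + K + 1 →
      (∀ i j, |Ψ i j| ≤ L) →
      u * ENNReal.ofReal (2 ^ (-((ν + K + 1) / 2)) * Real.exp (-(K ^ 2 * L)))
        ≤ ∫⁻ s, invWishartKernel Ψ ν s := by
  -- The kernel is bounded below on a fixed neighbourhood `U` of the identity; `u` is its volume,
  -- hence independent of `Ψ`, `ν` and `L`.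
  set s₁ : SymEntries K := fun z => open Classical in if z.IsDiag then (1 : ℝ) else 0 with hs₁
  have h1 : symMatrix s₁ = 1 := symMatrix_isDiag
  have hdet : ∀ᶠ s in 𝓝 s₁, (symMatrix s).det < 2 := by
    refine (continuous_symMatrix.matrix_det.tendsto s₁).eventually_lt_const ?_
    rw [h1, Matrix.det_one]; norm_num
  have hinv : ∀ᶠ s in 𝓝 s₁, ∀ i j, |(symMatrix s)⁻¹ i j| < 2 := by
    rw [eventually_all]; intro i
    rw [eventually_all]; intro j
    have hc : ContinuousAt (fun s : SymEntries K => |(symMatrix s)⁻¹ i j|) s₁ := by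
      simp only [Matrix.inv_def, Ring.inverse_eq_inv', Matrix.smul_apply, smul_eq_mul]
      refine ContinuousAt.abs (ContinuousAt.mul (ContinuousAt.inv₀ ?_ ?_) ?_)
      · exact continuous_symMatrix.matrix_det.continuousAt
      · rw [h1, Matrix.det_one]; exact one_ne_zero
      · exact (continuous_symMatrix.matrix_adjugate.matrix_elem i j).continuousAt
    have hlt : |(symMatrix s₁)⁻¹ i j| < 2 := by
      rw [h1, inv_one, Matrix.one_apply]
      split_ifs <;> norm_num
    exact hc.eventually_lt_const hlt
  have hpd : ∀ᶠ s in 𝓝 s₁, (symMatrix s).PosDef :=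
    isOpen_posDef_symMatrix.mem_nhds 
      (show (symMatrix s₁).PosDef from h1 ▸ Matrix.PosDef.one)
  obtain ⟨U, hU, hUo, hsU⟩ := mem_nhds_iff.1 (hpd.and (hdet.and hinv))
  refine ⟨volume U, (hUo.measure_pos volume ⟨s₁, hsU⟩).ne', fun Ψ ν L hν hL => ?_⟩
  rw [mul_comm, ← setLIntegral_const]
  refine (setLIntegral_mono' hUo.measurableSet fun s hs => ?_).trans (setLIntegral_le_lintegral U _)
  obtain ⟨hspd, hsdet, hsinv⟩ := hU hs
  rw [invWishartKernel, if_pos hspd, neg_div]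
  refine ENNReal.ofReal_le_ofReal (mul_le_mul ?_ ?_ (Real.exp_pos _).le
    (Real.rpow_nonneg hspd.det_pos.le _))
  · exact Real.rpow_le_rpow_of_nonpos hspd.det_pos hsdet.le (by linarith)
  · have htr : (Ψ * (symMatrix s)⁻¹).trace ≤ ∑ _i : Fin K, ∑ _j : Fin K, L * 2 := by
      simp only [Matrix.trace, Matrix.diag, Matrix.mul_apply]
      refine Finset.sum_le_sum fun i _ => Finset.sum_le_sum fun j _ => ?_
      refine (le_abs_self _).trans ?_
      rw [abs_mul]
      exact mul_le_mul (hL i j) (hsinv j i).le (abs_nonneg _) ((abs_nonneg _).trans (hL i j))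
    simp only [Finset.sum_const, Finset.card_univ, Fintype.card_fin, nsmul_eq_mul] at htr
    exact Real.exp_le_exp.2 (by nlinarith)

end InverseWishart

/-! ### Concentration of the Normal-Inverse-Wishart distribution for large samples. -/

section Concentration

/-- Once `√n ≥ 2E` the ratio `E / (1 + √n)` is at most `1/2`, and it is raised to a power tending to
infinity. -/
theorem tendsto_rpow_mul_one_add_sqrt_rpow {E : ℝ} (hE : 1 ≤ E) (b q : ℝ) :
    Tendsto (fun n : ℕ => E ^ ((b + n) / 2) * (1 + √(n : ℝ)) ^ (-((b + n) / 2 - q)))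
      atTop (𝓝 0) := by
  have hE0 : 0 < E := one_pos.trans_le hE
  have ha : Tendsto (fun n : ℕ => (b + (n : ℝ)) / 2 - q) atTop atTop :=
    tendsto_atTop_add_const_right _ _
      ((tendsto_atTop_add_const_left _ _ tendsto_natCast_atTop_atTop).atTop_div_const two_pos)
  have hlim : Tendsto (fun n : ℕ => E ^ q * (1 / 2 : ℝ) ^ ((b + (n : ℝ)) / 2 - q)) atTop (𝓝 0) := by
    have := ((tendsto_rpow_atTop_of_base_lt_one (1 / 2 : ℝ) (by norm_num) (by norm_num)).comp
      ha).const_mul (E ^ q)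
    rwa [mul_zero] at this
  have hsq : Tendsto (fun n : ℕ => √(n : ℝ)) atTop atTop :=
    Real.tendsto_sqrt_atTop.comp tendsto_natCast_atTop_atTop
  refine squeeze_zero' (.of_forall fun n => by positivity) ?_ hlim
  filter_upwards [ha.eventually_ge_atTop 0, hsq.eventually_ge_atTop (2 * E)] with n hn hs
  have h1 : 0 < 1 + √(n : ℝ) := by positivity
  have h2 : E ^ ((b + n) / 2) = E ^ q * E ^ ((b + n) / 2 - q) := by
    rw [← Real.rpow_add hE0]; congr 1; ring
  rw [h2, mul_assoc, Real.rpow_neg h1.le, ← div_eq_mul_inv, ← Real.div_rpow hE0.le h1.le]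
  refine mul_le_mul_of_nonneg_left (Real.rpow_le_rpow (by positivity) ?_ hn) (by positivity)
  rw [div_le_iff₀ h1]
  linarith

variable {K : ℕ} [NeZero K]

/-- For large sample sizes the inverse-Wishart kernel of a scale matrix of the order `n` is
integrable, and its normalization gives small mass to `{‖s‖ > √n}`. -/
theorem eventually_invWishart_tail_le (ν₀ : ℝ) (hν₀ : (K : ℝ) - 1 < ν₀) {p C : ℝ} (hp : 0 < p)
    (hC : 0 ≤ C) {ρ : ℝ≥0∞} (hρ : ρ ≠ 0) :
    ∀ᶠ n : ℕ in atTop, ∀ Ψ : Matrix (Fin K) (Fin K) ℝ,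
      (∀ v, p * n * (v ⬝ᵥ v) ≤ v ⬝ᵥ (Ψ *ᵥ v)) → (∀ i j, |Ψ i j| ≤ C * n) →
      ∫⁻ s, invWishartKernel Ψ (ν₀ + n) s ≠ 0 ∧ ∫⁻ s, invWishartKernel Ψ (ν₀ + n) s ≠ ∞ ∧
      ∫⁻ s in {s | √(n : ℝ) < ‖s‖}, invWishartDensity Ψ (ν₀ + n) s ≤ ρ := by
  obtain ⟨u, hu, hlow⟩ := exists_le_lintegral_invWishartKernel K
  -- Once `n ≥ b`, the ratio `(b + n) / (p n)` required by the kernel bound is at most `2 / p`.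
  set B : ℝ := max 1 (2 / p) with hBdef
  have hB : 1 ≤ B := le_max_left _ _
  set b : ℝ := ν₀ + K + 1 with hb
  have hK1 : (1 : ℝ) ≤ K := by exact_mod_cast NeZero.one_le
  have hb0 : 0 < b := by linarith
  set D : ℝ := 2 * B ^ K with hD
  have hD1 : 1 ≤ D := by
    have := one_le_pow₀ hB (n := K)
    linarith
  -- `D` comes from the upper bound of the kernel, the other factor from the lower bound of its
  -- integral.
  set E : ℝ := D * (2 * Real.exp (2 * (K ^ 2 * C))) with hE
  have hexp1 : 1 ≤ Real.exp (2 * (K ^ 2 * C)) := Real.one_le_exp (by positivity)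
  have hE1 : 1 ≤ E := by nlinarith
  -- One more than the dimension, so that `(1 + ‖s‖) ^ (-q)` is integrable.
  set q : ℝ := Module.finrank ℝ (SymEntries K) + 1 with hq
  set I : ℝ≥0∞ := ∫⁻ s : SymEntries K, ENNReal.ofReal ((1 + ‖s‖) ^ (-q)) with hI
  have hIfin : I ≠ ∞ := (finite_integral_one_add_norm (by rw [hq]; linarith)).ne
  have hu' : u⁻¹ * I ≠ ∞ := ENNReal.mul_ne_top (ENNReal.inv_ne_top.2 hu) hIfin
  have hlim : Tendsto (fun n : ℕ => u⁻¹ * I * ENNReal.ofReal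
      (E ^ ((b + n) / 2) * (1 + √(n : ℝ)) ^ (-((b + n) / 2 - q)))) atTop (𝓝 0) := by
    have h1 := ENNReal.tendsto_ofReal (tendsto_rpow_mul_one_add_sqrt_rpow hE1 b q)
    have h2 := ENNReal.Tendsto.const_mul h1 (.inr hu')
    rwa [ENNReal.ofReal_zero, mul_zero] at h2
  filter_upwards [hlim.eventually_le_const (pos_iff_ne_zero.2 hρ), eventually_ge_atTop 1,
    tendsto_natCast_atTop_atTop.eventually_ge_atTop b,
    tendsto_natCast_atTop_atTop.eventually_ge_atTop (2 * q)] with n hn hn1 hnb hnq Ψ hΨ hΨC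
  have hn0 : (0 : ℝ) < n := by exact_mod_cast hn1
  set a : ℝ := (b + n) / 2 with ha
  have haq : q ≤ a := by rw [ha]; linarith
  have ha0 : 0 < a := by positivity
  have haν : (ν₀ + n + K + 1) / 2 = a := by rw [ha, hb]; ring
  have hker : ∀ s, invWishartKernel Ψ (ν₀ + n) s ≤ ENNReal.ofReal (D ^ a * (1 + ‖s‖) ^ (-a)) := by
    intro s
    have := invWishartKernel_le (ν := ν₀ + n) (P := p * n) (B := B) (by linarith) (by positivity)
      hB ?_ hΨ s
    · rwa [haν] at this
    · refine le_trans ?_ (le_max_right _ _)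
      rw [div_le_div_iff₀ (by positivity) hp]
      have : ν₀ + n + K + 1 ≤ 2 * n := by linarith
      nlinarith
  have hlow' := hlow Ψ (ν₀ + n) (C * n) (by linarith) hΨC
  rw [haν] at hlow'
  set N := ∫⁻ s, invWishartKernel Ψ (ν₀ + n) s with hN
  set w : ℝ := 2 ^ (-a) * Real.exp (-(K ^ 2 * (C * n))) with hw
  have hw0 : 0 < w := by positivity
  have huw0 : u * ENNReal.ofReal w ≠ 0 :=
    mul_ne_zero hu (by simpa using hw0)
  have hN0 : N ≠ 0 := fun h => huw0 (le_antisymm (h ▸ hlow') zero_le)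
  have htail : ∀ R : ℝ, 0 ≤ R → ∫⁻ s in {s | R < ‖s‖}, invWishartKernel Ψ (ν₀ + n) s
      ≤ ENNReal.ofReal (D ^ a * (1 + R) ^ (-(a - q))) * I := by
    intro R hR
    rw [hI, ← lintegral_const_mul' _ _ ENNReal.ofReal_ne_top]
    refine le_trans ?_ (setLIntegral_le_lintegral {s | R < ‖s‖} _)
    refine setLIntegral_mono' (measurableSet_lt measurable_const measurable_norm) fun s hs => ?_
    refine (hker s).trans ?_
    rw [← ENNReal.ofReal_mul (by positivity)]
    refine ENNReal.ofReal_le_ofReal ?_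
    -- The power `q` is spent on integrability; the remaining `a - q` gives the decay in `R`.
    have h1 : (1 + ‖s‖) ^ (-a) = (1 + ‖s‖) ^ (-(a - q)) * (1 + ‖s‖) ^ (-q) := by
      rw [← Real.rpow_add (by positivity)]; congr 1; ring
    rw [h1, ← mul_assoc]
    refine mul_le_mul_of_nonneg_right (mul_le_mul_of_nonneg_left ?_ (by positivity)) (by positivity)
    have hs' : R < ‖s‖ := hs
    exact Real.rpow_le_rpow_of_nonpos (by positivity) (by linarith) (by linarith)
  have hNfin : N ≠ ∞ := by
    refine ne_top_of_le_ne_top (b := ENNReal.ofReal (D ^ a) * ∫⁻ s : SymEntries K,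
      ENNReal.ofReal ((1 + ‖s‖) ^ (-a))) ?_ ?_
    · refine ENNReal.mul_ne_top ENNReal.ofReal_ne_top (finite_integral_one_add_norm ?_).ne
      rw [hq] at haq; linarith
    · rw [← lintegral_const_mul' _ _ ENNReal.ofReal_ne_top]
      refine lintegral_mono fun s => (hker s).trans_eq ?_
      rw [ENNReal.ofReal_mul (by positivity)]
  refine ⟨hN0, hNfin, le_trans ?_ hn⟩
  simp only [invWishartDensity, div_eq_mul_inv]
  rw [lintegral_mul_const' _ _ (ENNReal.inv_ne_top.2 hN0)]
  calc (∫⁻ s in {s | √(n : ℝ) < ‖s‖}, invWishartKernel Ψ (ν₀ + n) s) * N⁻¹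
      ≤ (ENNReal.ofReal (D ^ a * (1 + √(n : ℝ)) ^ (-(a - q))) * I) *
          (u * ENNReal.ofReal w)⁻¹ :=
        mul_le_mul' (htail _ (Real.sqrt_nonneg _)) (ENNReal.inv_le_inv.2 hlow')
    _ = u⁻¹ * I * ENNReal.ofReal (D ^ a * (1 + √(n : ℝ)) ^ (-(a - q)) * w⁻¹) := by
        rw [ENNReal.mul_inv (.inl hu) (.inr (by simpa using hw0)),
          ENNReal.ofReal_mul (p := D ^ a * (1 + √(n : ℝ)) ^ (-(a - q))) (by positivity),
          ENNReal.ofReal_inv_of_pos hw0]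
        ring
    _ ≤ _ := by
        gcongr u⁻¹ * I * ENNReal.ofReal ?_
        -- `n ≤ 2a` turns the factor `exp (K² C n)` into an `a`-th power.
        have hwinv : w⁻¹ ≤ (2 * Real.exp (2 * (K ^ 2 * C))) ^ a := by
          rw [hw, mul_inv, Real.rpow_neg two_pos.le, inv_inv, Real.exp_neg, inv_inv,
            Real.mul_rpow two_pos.le (Real.exp_pos _).le, ← Real.exp_mul]
          refine mul_le_mul_of_nonneg_left (Real.exp_le_exp.2 ?_) (by positivity)
          have : (n : ℝ) ≤ 2 * a := by rw [ha]; linarith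
          have h0 : 0 ≤ (K : ℝ) ^ 2 * C := by positivity
          nlinarith
        calc D ^ a * (1 + √(n : ℝ)) ^ (-(a - q)) * w⁻¹
            ≤ D ^ a * (1 + √(n : ℝ)) ^ (-(a - q)) * (2 * Real.exp (2 * (K ^ 2 * C))) ^ a :=
              mul_le_mul_of_nonneg_left hwinv (by positivity)
          _ = _ := by
              rw [hE, Real.mul_rpow (x := D) (by positivity) (by positivity)]; ring

/-- Concentration of the mean component of the Normal-Inverse-Wishart distribution. -/
theorem eventually_normalInvWishart_concentration (l₀ : ℝ) (hl₀ : 0 < l₀) (ν₀ : ℝ)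
    (hν₀ : (K : ℝ) - 1 < ν₀) {p C e : ℝ} (hp : 0 < p) (hC : 0 ≤ C) (he : 0 < e) {ρ : ℝ≥0∞}
    (hρ : ρ ≠ 0) :
    ∀ᶠ n : ℕ in atTop, ∀ (m : Fin K → ℝ) (Ψ : Matrix (Fin K) (Fin K) ℝ),
      (∀ v, p * n * (v ⬝ᵥ v) ≤ v ⬝ᵥ (Ψ *ᵥ v)) → (∀ i j, |Ψ i j| ≤ C * n) →
      normalInvWishart m (l₀ + n) Ψ (ν₀ + n) Set.univ = 1 ∧
      normalInvWishart m (l₀ + n) Ψ (ν₀ + n) {x | ∃ k, e ≤ |x.1 k - m k|} ≤ ρ := by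
  have hK0 : (K : ℝ≥0∞) ≠ 0 := by exact_mod_cast NeZero.ne K
  have hρ' : ρ / K / 2 ≠ 0 := by
    simp [ENNReal.div_eq_zero_iff, hρ]
  have hlim : Tendsto (fun n : ℕ => ENNReal.ofReal (2 ^ ((K : ℝ) / 2) *
      Real.exp (-(e ^ 2 / 4 * √(n : ℝ))))) atTop (𝓝 0) := by
    have hsq : Tendsto (fun n : ℕ => e ^ 2 / 4 * √(n : ℝ)) atTop atTop :=
      (Real.tendsto_sqrt_atTop.comp tendsto_natCast_atTop_atTop).const_mul_atTop (by positivity)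
    have h1 := ENNReal.tendsto_ofReal
      ((Real.tendsto_exp_neg_atTop_nhds_zero.comp hsq).const_mul (2 ^ ((K : ℝ) / 2)))
    simpa using h1
  filter_upwards [eventually_invWishart_tail_le ν₀ hν₀ hp hC hρ',
    hlim.eventually_le_const (pos_iff_ne_zero.2 hρ'), eventually_ge_atTop 1]
    with n hn ht hn1 m Ψ hΨ hΨC
  obtain ⟨hN0, hNfin, htail⟩ := hn Ψ hΨ hΨC
  have hn0 : (0 : ℝ) < n := by exact_mod_cast hn1
  have hl : 0 < l₀ + n := by positivity
  have hmass : ∫⁻ s, invWishartDensity Ψ (ν₀ + n) s = 1 := by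
    simp only [invWishartDensity, div_eq_mul_inv]
    rw [lintegral_mul_const' _ _ (ENNReal.inv_ne_top.2 hN0), ENNReal.mul_inv_cancel hN0 hNfin]
  have hzero : ∀ s, ¬ (symMatrix s).PosDef → invWishartDensity Ψ (ν₀ + n) s = 0 := fun s hs => by
    simp [invWishartDensity, invWishartKernel, hs]
  have hposs : ∀ s : SymEntries K, (symMatrix s).PosDef →
      ((l₀ + n : ℝ)⁻¹ • symMatrix s).PosDef := fun s hs => hs.smul (inv_pos.2 hl)
  refine ⟨?_, ?_⟩
  · rw [← Set.preimage_univ (f := Prod.fst), normalInvWishart_preimage_fst _ _ _ _ .univ, ← hmass]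
    refine lintegral_congr fun s => ?_
    by_cases hs : (symMatrix s).PosDef
    · rw [Measure.restrict_univ, lintegral_gaussianDensity m (hposs s hs), mul_one]
    · rw [hzero s hs, zero_mul]
  · have hk : ∀ k, normalInvWishart m (l₀ + n) Ψ (ν₀ + n)
        (Prod.fst ⁻¹' {x : Fin K → ℝ | e ≤ |x k - m k|}) ≤ ρ / K := by
      intro k
      rw [normalInvWishart_preimage_fst _ _ _ _ (measurableSet_le measurable_const (by fun_prop))]
      -- On `T` only the small inverse-Wishart mass counts. Off `T` the variance of coordinate `k`
      -- is at most `√n / (l₀ + n) ≤ 1 / √n`, so the Gaussian tail is small.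
      set T : Set (SymEntries K) := {s | √(n : ℝ) < ‖s‖} with hT
      have hTm : MeasurableSet T := measurableSet_lt measurable_const measurable_norm
      rw [← lintegral_add_compl _ hTm, ← ENNReal.add_halves (ρ / K)]
      refine add_le_add ?_ ?_
      · refine le_trans (lintegral_mono fun s => ?_) htail
        by_cases hs : (symMatrix s).PosDef
        · refine mul_le_of_le_one_right zero_le ?_
          rw [← lintegral_gaussianDensity m (hposs s hs)]
          exact setLIntegral_le_lintegral _ _
        · rw [hzero s hs, zero_mul]
      · calc ∫⁻ s in Tᶜ, invWishartDensity Ψ (ν₀ + n) s *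
              ∫⁻ x in {x | e ≤ |x k - m k|}, ENNReal.ofReal
                (gaussianDensity m ((l₀ + n)⁻¹ • symMatrix s) x)
            ≤ ∫⁻ s in Tᶜ, invWishartDensity Ψ (ν₀ + n) s * (ρ / K / 2) := by
              refine setLIntegral_mono' hTm.compl fun s hs => ?_
              by_cases hpd : (symMatrix s).PosDef
              · refine mul_le_mul_right ?_ _
                have hsn : symMatrix s k k ≤ √(n : ℝ) := by
                  refine (le_abs_self _).trans ((norm_le_pi_norm s s(k, k)).trans ?_)
                  simpa [hT] using hs
                have hle : ((l₀ + n : ℝ)⁻¹ • symMatrix s) k k ≤ (√(n : ℝ))⁻¹ := by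
                  rw [Matrix.smul_apply, smul_eq_mul, inv_mul_le_iff₀ hl]
                  refine hsn.trans ?_
                  rw [← div_eq_mul_inv, le_div_iff₀ (Real.sqrt_pos.2 hn0),
                    Real.mul_self_sqrt hn0.le]
                  linarith
                refine (setLIntegral_gaussianDensity_le m (hposs s hpd) k he.le hle).trans
                  (le_trans (le_of_eq ?_) ht)
                congr 4
                have := Real.sqrt_pos.2 hn0
                field_simp
              · rw [hzero s hpd, zero_mul, zero_mul]
          _ ≤ ∫⁻ s, invWishartDensity Ψ (ν₀ + n) s * (ρ / K / 2) :=
              setLIntegral_le_lintegral _ _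
          _ = ρ / K / 2 := by
              rw [lintegral_mul_const _ (measurable_invWishartDensity _ _), hmass, one_mul]
    have hset : {x : (Fin K → ℝ) × SymEntries K | ∃ k, e ≤ |x.1 k - m k|}
        = ⋃ k, Prod.fst ⁻¹' {x : Fin K → ℝ | e ≤ |x k - m k|} := by
      ext x; simp
    rw [hset]
    calc _ ≤ ∑ k : Fin K, normalInvWishart m (l₀ + n) Ψ (ν₀ + n)
            (Prod.fst ⁻¹' {x : Fin K → ℝ | e ≤ |x k - m k|}) := measure_iUnion_fintype_le _ _
      _ ≤ ∑ _k : Fin K, ρ / K := Finset.sum_le_sum fun k _ => hk k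
      _ = ρ := by
        rw [Finset.sum_const, Finset.card_univ, Fintype.card_fin, nsmul_eq_mul,
          ENNReal.mul_div_cancel hK0 (ENNReal.natCast_ne_top K)]

end Concentration

/-! ### Convergence in probability as convergence along a filter. -/

section ConvergenceInProbability

variable {Ω : Type*} [MeasurableSpace Ω]

/-- The filter of events that hold with probability tending to one. Convergence in probability is
convergence along this filter. -/
def withHighProbability (P : Measure Ω) : Filter (ℕ × Ω) where
  sets := {A | Tendsto (fun n => P {ω | (n, ω) ∉ A}) atTop (𝓝 0)}
  univ_sets := by simp
  sets_of_superset {A B} hA hAB := tendsto_of_tendsto_of_tendsto_of_le_of_le tendsto_const_nhds hA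
    (fun _ => zero_le) fun _ => measure_mono fun _ hω h => hω (hAB h)
  inter_sets {A B} hA hB := by
    have h : Tendsto (fun n => P {ω | (n, ω) ∉ A} + P {ω | (n, ω) ∉ B}) atTop (𝓝 0) := by
      simpa using Tendsto.add hA hB
    refine tendsto_of_tendsto_of_tendsto_of_le_of_le tendsto_const_nhds h (fun _ => zero_le)
      fun n => ?_
    refine (measure_mono fun ω hω => ?_).trans (measure_union_le _ _)
    by_cases hA' : (n, ω) ∈ A
    · exact .inr fun hB' => hω ⟨hA', hB'⟩
    · exact .inl hA'

theorem mem_withHighProbability {P : Measure Ω} {A : Set (ℕ × Ω)} :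
    A ∈ withHighProbability P ↔ Tendsto (fun n => P {ω | (n, ω) ∉ A}) atTop (𝓝 0) :=
  Iff.rfl

theorem tendsto_fst_withHighProbability (P : Measure Ω) :
    Tendsto Prod.fst (withHighProbability P) atTop := by
  refine tendsto_atTop.2 fun N => ?_
  refine mem_withHighProbability.2 (tendsto_const_nhds.congr' ?_)
  filter_upwards [eventually_ge_atTop N] with n hn
  simp [hn]

theorem tendstoInMeasure_const_iff {P : Measure Ω} {f : ℕ → Ω → ℝ} {c : ℝ} :
    TendstoInMeasure P f atTop (fun _ => c) ↔
      Tendsto (fun q : ℕ × Ω => f q.1 q.2) (withHighProbability P) (𝓝 c) := by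
  rw [EMetric.tendsto_nhds]
  refine forall₂_congr fun ε _ => ?_
  refine Iff.trans ?_ mem_withHighProbability.symm
  simp

/-- On the event `|Y| ≤ M / √n` the quantity is at most `M² / √n`. This is the form in which the
estimator rate enters the loss comparison. -/
theorem IsBigOInProbability.tendsto_sqrt_mul_sq {P : Measure Ω} {Y : ℕ → Ω → ℝ}
    (h : IsBigOInProbability P Y fun n => 1 / √(n : ℝ)) :
    Tendsto (fun q : ℕ × Ω => √(q.1 : ℝ) * Y q.1 q.2 ^ 2) (withHighProbability P) (𝓝 0) := by
  rw [Metric.tendsto_nhds]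
  intro e he
  refine mem_withHighProbability.2 ?_
  rw [ENNReal.tendsto_nhds_zero]
  intro ε hε
  obtain ⟨M, hM⟩ := h ε hε
  have hsq : Tendsto (fun n : ℕ => √(n : ℝ)) atTop atTop :=
    Real.tendsto_sqrt_atTop.comp tendsto_natCast_atTop_atTop
  filter_upwards [hM, hsq.eventually_gt_atTop (M ^ 2 / e), eventually_ge_atTop 1] with n hn hs hn1
  refine (measure_mono fun ω hω => ?_).trans hn
  have hn0 : 0 < √(n : ℝ) := Real.sqrt_pos.2 (by exact_mod_cast hn1)
  by_contra hlt
  refine hω ?_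
  have hle : |Y n ω| ≤ M * (1 / √(n : ℝ)) := not_lt.1 hlt
  have h2 : Y n ω ^ 2 ≤ (M * (1 / √(n : ℝ))) ^ 2 := by
    rw [← sq_abs]; exact pow_le_pow_left₀ (abs_nonneg _) hle 2
  have h3 : √(n : ℝ) * Y n ω ^ 2 < e := by
    calc √(n : ℝ) * Y n ω ^ 2 ≤ √(n : ℝ) * (M * (1 / √(n : ℝ))) ^ 2 :=
          mul_le_mul_of_nonneg_left h2 hn0.le
      _ = M ^ 2 / √(n : ℝ) := by field_simp
      _ < e := by rwa [div_lt_comm₀ hn0 he]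
  rw [Real.dist_0_eq_abs, abs_of_nonneg (by positivity)]
  exact h3

theorem tendsto_sq_of_tendsto_sqrt_mul_sq {P : Measure Ω} {Y : ℕ × Ω → ℝ}
    (h : Tendsto (fun q => √(q.1 : ℝ) * Y q ^ 2) (withHighProbability P) (𝓝 0)) :
    Tendsto (fun q => Y q ^ 2) (withHighProbability P) (𝓝 0) := by
  refine squeeze_zero' (.of_forall fun q => sq_nonneg _) ?_ h
  filter_upwards [(tendsto_fst_withHighProbability P).eventually_ge_atTop 1] with q hq
  exact le_mul_of_one_le_left (sq_nonneg _) (Real.one_le_sqrt.2 (by exact_mod_cast hq))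

/-- The weak law of large numbers. -/
theorem tendsto_mean_withHighProbability {𝒳 : Type*} [MeasurableSpace 𝒳] {P : Measure Ω}
    [IsProbabilityMeasure P] {P₀ : Measure 𝒳} {X : ℕ → Ω → 𝒳} (hX : ∀ i, Measurable (X i))
    (hind : iIndepFun X P) (hlaw : ∀ i, P.map (X i) = P₀) {g : 𝒳 → ℝ} (hg : Integrable g P₀) :
    Tendsto (fun q : ℕ × Ω => (∑ i : Fin q.1, g (X i q.2)) / q.1) (withHighProbability P)
      (𝓝 (∫ x, g x ∂P₀)) := by
  have hgi : ∀ i, Integrable g (P.map (X i)) := fun i => by rwa [hlaw i]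
  have hint : ∀ i, Integrable (fun ω => g (X i ω)) P := fun i => (hgi i).comp_measurable (hX i)
  have hident : ∀ i, IdentDistrib (fun ω => g (X i ω)) (fun ω => g (X 0 ω)) P P := fun i =>
    IdentDistrib.comp_of_aemeasurable
      (⟨(hX i).aemeasurable, (hX 0).aemeasurable, by rw [hlaw, hlaw]⟩ : IdentDistrib (X i) (X 0) P P)
      (hgi i).aemeasurable
  have hlln := strong_law_ae_real (fun i ω => g (X i ω)) (hint 0)
    (fun i j hij => (hind.indepFun hij).comp₀ (hX i).aemeasurable (hX j).aemeasurable
      (hgi i).aemeasurable (hgi j).aemeasurable) hident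
  have hmean : ∫ ω, g (X 0 ω) ∂P = ∫ x, g x ∂P₀ := by
    rw [← hlaw 0, integral_map (hX 0).aemeasurable (hgi 0).aestronglyMeasurable]
  rw [hmean] at hlln
  have := tendstoInMeasure_of_tendsto_ae (g := fun _ => ∫ x, g x ∂P₀) (fun n => ?_) hlln
  · rw [tendstoInMeasure_const_iff] at this
    simpa only [Finset.sum_range] using this
  · exact ((integrable_finsetSum (Finset.range n) fun i _ => hint i).div_const
      (n : ℝ)).aestronglyMeasurable

end ConvergenceInProbability

/-! ### Stability of empirical moments under mean-square perturbations. -/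

section Means

theorem abs_mean_mul_le {n : ℕ} (a b : Fin n → ℝ) :
    |(∑ i, a i * b i) / n| ≤ √(((∑ i, a i ^ 2) / n) * ((∑ i, b i ^ 2) / n)) := by
  refine Real.abs_le_sqrt ?_
  rw [div_pow, div_mul_div_comm, ← sq (n : ℝ)]
  exact div_le_div_of_nonneg_right (Finset.sum_mul_sq_le_sq_mul_sq _ _ _) (by positivity)

variable {ι : Type*} {F : Filter ι} {N : ι → ℕ}

theorem tendsto_mean_mul_zero {a b : (t : ι) → Fin (N t) → ℝ} {c : ℝ}
    (ha : Tendsto (fun t => (∑ i, a t i ^ 2) / N t) F (𝓝 0))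
    (hb : Tendsto (fun t => (∑ i, b t i ^ 2) / N t) F (𝓝 c)) :
    Tendsto (fun t => (∑ i, a t i * b t i) / N t) F (𝓝 0) := by
  rw [tendsto_zero_iff_abs_tendsto_zero]
  have h := (Real.continuous_sqrt.tendsto _).comp (ha.mul hb)
  rw [zero_mul, Real.sqrt_zero] at h
  exact squeeze_zero (fun t => abs_nonneg _) (fun t => abs_mean_mul_le _ _) h

theorem tendsto_mean_of_mean_sub_sq {W Z : (t : ι) → Fin (N t) → ℝ} {c : ℝ}
    (hN : Tendsto N F atTop)
    (hD : Tendsto (fun t => (∑ i, (Z t i - W t i) ^ 2) / N t) F (𝓝 0))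
    (hW : Tendsto (fun t => (∑ i, W t i) / N t) F (𝓝 c)) :
    Tendsto (fun t => (∑ i, Z t i) / N t) F (𝓝 c) := by
  -- The mean of `Z - W` is handled by Cauchy–Schwarz against the constant `1`.
  have h1 : Tendsto (fun t => (∑ _i : Fin (N t), (1 : ℝ) ^ 2) / N t) F (𝓝 1) := by
    refine tendsto_const_nhds.congr' ?_
    filter_upwards [hN.eventually_ge_atTop 1] with t ht
    have : (N t : ℝ) ≠ 0 := by positivity
    simp [this]
  have h2 := (tendsto_mean_mul_zero hD h1).add hW
  rw [zero_add] at h2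
  refine h2.congr fun t => ?_
  rw [← add_div, ← Finset.sum_add_distrib]
  simp

/-- Expand `Z Z'` around `W W'`; Cauchy–Schwarz kills the three terms containing a difference. -/
theorem tendsto_mean_mul_of_mean_sub_sq {W Z W' Z' : (t : ι) → Fin (N t) → ℝ} {c s s' : ℝ}
    (hD : Tendsto (fun t => (∑ i, (Z t i - W t i) ^ 2) / N t) F (𝓝 0))
    (hD' : Tendsto (fun t => (∑ i, (Z' t i - W' t i) ^ 2) / N t) F (𝓝 0))
    (hW : Tendsto (fun t => (∑ i, W t i ^ 2) / N t) F (𝓝 s))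
    (hW' : Tendsto (fun t => (∑ i, W' t i ^ 2) / N t) F (𝓝 s'))
    (hWW : Tendsto (fun t => (∑ i, W t i * W' t i) / N t) F (𝓝 c)) :
    Tendsto (fun t => (∑ i, Z t i * Z' t i) / N t) F (𝓝 c) := by
  have h := ((hWW.add (tendsto_mean_mul_zero hD hW')).add (tendsto_mean_mul_zero hD' hW)).add
    (tendsto_mean_mul_zero hD hD')
  simp only [add_zero] at h
  refine h.congr fun t => ?_
  simp only [← add_div, ← Finset.sum_add_distrib]
  congr 1
  exact Finset.sum_congr rfl fun i _ => by ring

end Means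

/-! ### Second-order control of the change in loss. -/

section Taylor

/-- Two mean value inequalities: the derivative is `H`-Lipschitz on the ball, and then `f` minus its
linear part is controlled on the closed ball through `x`. The Taylor factor `1/2` is given away. -/
theorem abs_sub_le_of_norm_iteratedFDeriv_two_le {E : Type*} [NormedAddCommGroup E]
    [InnerProductSpace ℝ E] [CompleteSpace E] {f : E → ℝ} {x₀ : E} {r H : ℝ}
    (hf : ContDiffOn ℝ 2 f (Metric.ball x₀ r))
    (hH : ∀ x ∈ Metric.ball x₀ r, ‖iteratedFDeriv ℝ 2 f x‖ ≤ H) {x : E}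
    (hx : x ∈ Metric.ball x₀ r) :
    |f x - f x₀| ≤ ‖gradient f x₀‖ * ‖x - x₀‖ + H * ‖x - x₀‖ ^ 2 := by
  have hr : 0 < r := Metric.pos_of_mem_ball hx
  have hx₀ : x₀ ∈ Metric.ball x₀ r := Metric.mem_ball_self hr
  have hH0 : 0 ≤ H := (norm_nonneg _).trans (hH x₀ hx₀)
  have hcd : ∀ y ∈ Metric.ball x₀ r, ContDiffAt ℝ 2 f y := fun y hy =>
    hf.contDiffAt (Metric.isOpen_ball.mem_nhds hy)
  have hd1 : ∀ y ∈ Metric.ball x₀ r, DifferentiableAt ℝ f y := fun y hy =>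
    (hcd y hy).differentiableAt (by norm_num)
  have hd2 : ∀ y ∈ Metric.ball x₀ r, DifferentiableAt ℝ (fderiv ℝ f) y := fun y hy =>
    ((hcd y hy).fderiv_right (m := 1) (by norm_num)).differentiableAt (by norm_num)
  have hb2 : ∀ y ∈ Metric.ball x₀ r, ‖fderiv ℝ (fderiv ℝ f) y‖ ≤ H := fun y hy => by
    rw [← norm_iteratedFDeriv_one, norm_iteratedFDeriv_fderiv]
    exact hH y hy
  have hlip : ∀ y ∈ Metric.ball x₀ r, ‖fderiv ℝ f y - fderiv ℝ f x₀‖ ≤ H * ‖y - x₀‖ :=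
    fun y hy => (convex_ball x₀ r).norm_image_sub_le_of_norm_fderiv_le hd2 hb2 hx₀ hy
  have hsub : Metric.closedBall x₀ ‖x - x₀‖ ⊆ Metric.ball x₀ r :=
    Metric.closedBall_subset_ball (by simpa [dist_eq_norm] using hx)
  have key := (convex_closedBall x₀ ‖x - x₀‖).norm_image_sub_le_of_norm_fderiv_le'
    (f := f) (φ := fderiv ℝ f x₀) (C := H * ‖x - x₀‖) (fun y hy => hd1 y (hsub hy))
    (fun y hy => (hlip y (hsub hy)).trans (mul_le_mul_of_nonneg_left
      (by simpa [dist_eq_norm] using hy) hH0))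
    (Metric.mem_closedBall_self (norm_nonneg _)) (by simp [dist_eq_norm] : x ∈ _)
  have hg : ‖gradient f x₀‖ = ‖fderiv ℝ f x₀‖ := by
    rw [gradient, LinearIsometryEquiv.norm_map]
  have hlin := (fderiv ℝ f x₀).le_opNorm (x - x₀)
  rw [hg]
  rw [Real.norm_eq_abs] at key hlin
  calc |f x - f x₀| = |(fderiv ℝ f x₀ (x - x₀)) + (f x - f x₀ - fderiv ℝ f x₀ (x - x₀))| := by
        congr 1; ring
    _ ≤ _ := (abs_add_le _ _).trans (by nlinarith)

/-- The envelope `H` will only have a first moment, so `∑ H i ^ 2` is bounded by `(∑ H i) ^ 2`. The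
factor `n` lost this way becomes the `√n` next to `η ^ 2`. -/
theorem mean_sq_le_of_abs_le {n : ℕ} {D G H : Fin n → ℝ} {η : ℝ} (hH : ∀ i, 0 ≤ H i)
    (h : ∀ i, |D i| ≤ G i * η + H i * η ^ 2) :
    (∑ i, D i ^ 2) / n ≤ 2 * η ^ 2 * ((∑ i, G i ^ 2) / n) +
      2 * (√(n : ℝ) * η ^ 2) ^ 2 * ((∑ i, H i) / n) ^ 2 := by
  rcases n.eq_zero_or_pos with rfl | hn
  · simp
  have hn0 : (0 : ℝ) < n := by exact_mod_cast hn
  have h1 : ∀ i, D i ^ 2 ≤ 2 * η ^ 2 * G i ^ 2 + 2 * (η ^ 2) ^ 2 * H i ^ 2 := fun i => by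
    have := pow_le_pow_left₀ (abs_nonneg _) (h i) 2
    rw [sq_abs] at this
    nlinarith [sq_nonneg (G i * η - H i * η ^ 2)]
  have h2 : ∑ i, D i ^ 2 ≤ 2 * η ^ 2 * ∑ i, G i ^ 2 + 2 * (η ^ 2) ^ 2 * (∑ i, H i) ^ 2 := by
    refine (Finset.sum_le_sum fun i _ => h1 i).trans ?_
    rw [Finset.sum_add_distrib, ← Finset.mul_sum, ← Finset.mul_sum]
    gcongr
    exact Finset.sum_sq_le_sq_sum_of_nonneg fun i _ => hH i
  rw [div_le_iff₀ hn0]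
  refine h2.trans_eq ?_
  rw [mul_pow √(n : ℝ), Real.sq_sqrt hn0.le]
  field_simp

end Taylor

/-! ### Limits of the sample mean and covariance of the losses. -/

section Losses

variable {Ω 𝒳 : Type*} [MeasurableSpace Ω] [MeasurableSpace 𝒳] {P : Measure Ω}
  [IsProbabilityMeasure P] {P₀ : Measure 𝒳} {X : ℕ → Ω → 𝒳}

/-- Replacing the optimal parameter by its estimator changes the losses by a negligible amount in
empirical mean square. -/
theorem RegularModel.tendsto_mean_sub_sq (hX : ∀ i, Measurable (X i)) (hind : iIndepFun X P)
    (hlaw : ∀ i, P.map (X i) = P₀) {d : ℕ} {Θ : Set (EuclideanSpace ℝ (Fin d))}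
    {ℓ : 𝒳 → EuclideanSpace ℝ (Fin d) → ℝ} {θs : EuclideanSpace ℝ (Fin d)}
    {θh : (n : ℕ) → (Fin n → 𝒳) → EuclideanSpace ℝ (Fin d)}
    (h : RegularModel P X P₀ Θ ℓ θs θh) :
    Tendsto (fun q : ℕ × Ω => (∑ i : Fin q.1, (ℓ (X i q.2) (θh q.1 fun i => X i q.2)
      - ℓ (X i q.2) θs) ^ 2) / q.1) (withHighProbability P) (𝓝 0) := by
  obtain ⟨r, hr, -, -, hcd, H, hH, hHint⟩ := h.regular
  have hH0 : ∀ x, 0 ≤ H x := fun x =>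
    (norm_nonneg _).trans (hH x θs (Metric.mem_ball_self hr))
  have hrate := h.estimator_rate.tendsto_sqrt_mul_sq
  have hsq := tendsto_sq_of_tendsto_sqrt_mul_sq hrate
  have hG := tendsto_mean_withHighProbability hX hind hlaw h.integrable_gradient_sq
  have hHm := tendsto_mean_withHighProbability hX hind hlaw hHint
  have hlim := ((hsq.const_mul 2).mul hG).add (((hrate.pow 2).const_mul 2).mul (hHm.pow 2))
  simp only [mul_zero, zero_mul, ne_eq, OfNat.ofNat_ne_zero, not_false_eq_true, zero_pow,
    add_zero] at hlim
  refine squeeze_zero' (.of_forall fun q => by positivity) ?_ hlim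
  -- With probability tending to one the estimator lies in the ball where the derivative bounds
  -- hold.
  filter_upwards [hsq.eventually_lt_const (pow_pos hr 2)] with q hq
  have hmem : θh q.1 (fun i => X i q.2) ∈ Metric.ball θs r := by
    rw [mem_ball_iff_norm]
    exact lt_of_pow_lt_pow_left₀ 2 hr.le hq
  exact mean_sq_le_of_abs_le (fun i => hH0 _) fun i =>
    abs_sub_le_of_norm_iteratedFDeriv_two_le (hcd _) (hH _) hmem

variable {K : ℕ} {d : Fin K → ℕ} {Θ : (k : Fin K) → Set (EuclideanSpace ℝ (Fin (d k)))}
  {ℓ : (k : Fin K) → 𝒳 → EuclideanSpace ℝ (Fin (d k)) → ℝ}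
  {θs : (k : Fin K) → EuclideanSpace ℝ (Fin (d k))}
  {θh : (k : Fin K) → (n : ℕ) → (Fin n → 𝒳) → EuclideanSpace ℝ (Fin (d k))}

theorem sampleMean_apply {n : ℕ} (z : Fin n → Fin K → ℝ) (k : Fin K) :
    sampleMean z k = (∑ i, z i k) / n := by
  simp [sampleMean, Finset.sum_apply, div_eq_inv_mul]

theorem sampleCov_apply {n : ℕ} (z : Fin n → Fin K → ℝ) (j k : Fin K) :
    sampleCov z j k = (∑ i, z i j * z i k) / n - sampleMean z j * sampleMean z k := by
  rcases n.eq_zero_or_pos with rfl | hn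
  · simp [sampleCov, sampleMean]
  have hn0 : (n : ℝ) ≠ 0 := by positivity
  have h : sampleCov z j k
      = (∑ i, (z i j - sampleMean z j) * (z i k - sampleMean z k)) / n := by
    simp [sampleCov, Matrix.sum_apply, Matrix.vecMulVec_apply, div_eq_inv_mul]
  have hm : ∀ k, ∑ i, z i k = n * sampleMean z k := fun k => by
    rw [sampleMean_apply]; field_simp
  rw [h]
  simp only [sub_mul, mul_sub, Finset.sum_sub_distrib, ← Finset.mul_sum, ← Finset.sum_mul, hm,
    Finset.sum_const, Finset.card_univ, Fintype.card_fin, nsmul_eq_mul]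
  field_simp
  ring

theorem tendsto_sampleMean_lossData (hX : ∀ i, Measurable (X i)) (hind : iIndepFun X P)
    (hlaw : ∀ i, P.map (X i) = P₀) [IsProbabilityMeasure P₀]
    (hmom : ∀ k, MemLp (fun x => ℓ k x (θs k)) 2 P₀)
    (hreg : ∀ k, RegularModel P X P₀ (Θ k) (ℓ k) (θs k) (θh k)) :
    Tendsto (fun q : ℕ × Ω => sampleMean (lossData ℓ θh fun i : Fin q.1 => X i q.2))
      (withHighProbability P) (𝓝 (trueMean P₀ ℓ θs)) := by
  refine tendsto_pi_nhds.2 fun k => ?_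
  simp only [sampleMean_apply, lossData]
  have hlln := tendsto_mean_withHighProbability hX hind hlaw ((hmom k).integrable one_le_two)
  exact tendsto_mean_of_mean_sub_sq (N := fun q : ℕ × Ω => q.1)
    (W := fun q i => ℓ k (X i q.2) (θs k))
    (Z := fun q i => ℓ k (X i q.2) (θh k q.1 fun i => X i q.2))
    (tendsto_fst_withHighProbability P) ((hreg k).tendsto_mean_sub_sq hX hind hlaw) hlln

theorem tendsto_sampleCov_lossData (hX : ∀ i, Measurable (X i)) (hind : iIndepFun X P)
    (hlaw : ∀ i, P.map (X i) = P₀) [IsProbabilityMeasure P₀]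
    (hmom : ∀ k, MemLp (fun x => ℓ k x (θs k)) 2 P₀)
    (hreg : ∀ k, RegularModel P X P₀ (Θ k) (ℓ k) (θs k) (θh k)) :
    Tendsto (fun q : ℕ × Ω => sampleCov (lossData ℓ θh fun i : Fin q.1 => X i q.2))
      (withHighProbability P) (𝓝 (trueCov P₀ ℓ θs)) := by
  refine tendsto_pi_nhds.2 fun j => tendsto_pi_nhds.2 fun k => ?_
  have hmean := tendsto_pi_nhds.1 (tendsto_sampleMean_lossData hX hind hlaw hmom hreg)
  have hcov : trueCov P₀ ℓ θs j k = ∫ x, ℓ j x (θs j) * ℓ k x (θs k) ∂P₀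
      - trueMean P₀ ℓ θs j * trueMean P₀ ℓ θs k := by
    rw [trueCov, Matrix.of_apply, covariance_eq_sub (hmom j) (hmom k)]
    rfl
  rw [hcov]
  simp only [sampleCov_apply]
  refine Tendsto.sub ?_ ((hmean j).mul (hmean k))
  have hsq : ∀ k, Tendsto (fun q : ℕ × Ω => (∑ i : Fin q.1, ℓ k (X i q.2) (θs k) ^ 2) / q.1)
      (withHighProbability P) (𝓝 (∫ x, ℓ k x (θs k) ^ 2 ∂P₀)) := fun k =>
    tendsto_mean_withHighProbability (g := fun x => ℓ k x (θs k) ^ 2) hX hind hlaw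
      (hmom k).integrable_sq
  have hprod := tendsto_mean_withHighProbability (g := fun x => ℓ j x (θs j) * ℓ k x (θs k))
    hX hind hlaw ((hmom j).integrable_mul (hmom k))
  exact tendsto_mean_mul_of_mean_sub_sq (N := fun q : ℕ × Ω => q.1)
    (W := fun q i => ℓ j (X i q.2) (θs j)) (W' := fun q i => ℓ k (X i q.2) (θs k))
    (Z := fun q i => ℓ j (X i q.2) (θh j q.1 fun i => X i q.2))
    (Z' := fun q i => ℓ k (X i q.2) (θh k q.1 fun i => X i q.2))
    ((hreg j).tendsto_mean_sub_sq hX hind hlaw)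
    ((hreg k).tendsto_mean_sub_sq hX hind hlaw) (hsq j) (hsq k) hprod

end Losses

/-! ### Local constancy of the minimal complexity and posterior selection. -/

section Selection

variable {K : ℕ} [NeZero K]

theorem continuous_iInf_apply : Continuous fun x : Fin K → ℝ => ⨅ j, x j := by
  have h : (fun x : Fin K → ℝ => ⨅ j, x j)
      = fun x => Finset.univ.inf' Finset.univ_nonempty fun j => x j :=
    funext fun x => (Finset.inf'_univ_eq_ciInf x).symm
  rw [h]
  exact Continuous.finset_inf'_apply _ fun j _ => continuous_apply j

theorem exists_minComplexity_eq {δ : ℝ} (c : Fin K → ℝ≥0) {m : Fin K → ℝ}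
    (hδ : ∀ k, δ ≠ m k - ⨅ j, m j) :
    ∃ e > 0, ∀ x : Fin K → ℝ, (∀ k, |x k - m k| < 2 * e) →
      minComplexity δ c x = minComplexity δ c m := by
  have hev : ∀ᶠ x in 𝓝 m, deltaOptimal δ x = deltaOptimal δ m := by
    have hk : ∀ᶠ x in 𝓝 m, ∀ k, x k ≤ (⨅ j, x j) + δ ↔ m k ≤ (⨅ j, m j) + δ := by
      refine eventually_all.2 fun k => ?_
      have h1 : Tendsto (fun x : Fin K → ℝ => x k) (𝓝 m) (𝓝 (m k)) :=
        (continuous_apply k).tendsto m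
      have h2 : Tendsto (fun x : Fin K → ℝ => (⨅ j, x j) + δ) (𝓝 m) (𝓝 ((⨅ j, m j) + δ)) :=
        (continuous_iInf_apply.tendsto m).add_const δ
      rcases lt_trichotomy (m k) ((⨅ j, m j) + δ) with h | h | h
      · filter_upwards [h1.eventually_lt h2 h] with x hx
        exact iff_of_true hx.le h.le
      · exact absurd (by linarith) (hδ k)
      · filter_upwards [h2.eventually_lt h1 h] with x hx
        exact iff_of_false hx.not_ge h.not_ge
    filter_upwards [hk] with x hx
    exact Set.ext hx
  obtain ⟨e, he, h⟩ := Metric.eventually_nhds_iff.1 hev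
  -- The radius is stated as `2 * e` to leave one `e` for the error of the posterior centre and one
  -- for the deviation from that centre.
  refine ⟨e / 2, half_pos he, fun x hx => ?_⟩
  have : dist x m < e := (dist_pi_lt_iff he).2 fun k => by
    rw [Real.dist_eq]
    linarith [hx k]
  rw [minComplexity, h this, minComplexity]

/-- If the sample means and covariance matrices converge, to a positive definite limit in the case
of the latter, then the posterior selects the minimal complexity of the limit. -/
theorem tendsto_posterior_minComplexity {ι : Type*} {F : Filter ι} {N : ι → ℕ}
    (hN : Tendsto N F atTop) {z : (t : ι) → Fin (N t) → Fin K → ℝ} {m : Fin K → ℝ}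
    {S : Matrix (Fin K) (Fin K) ℝ} (hS : S.PosDef)
    (hm : Tendsto (fun t => sampleMean (z t)) F (𝓝 m))
    (hcov : Tendsto (fun t => sampleCov (z t)) F (𝓝 S))
    (m₀ : Fin K → ℝ) {l₀ : ℝ} (hl₀ : 0 < l₀) {Ψ₀ : Matrix (Fin K) (Fin K) ℝ}
    (hΨ₀ : Ψ₀.PosDef) {ν₀ : ℝ} (hν₀ : (K : ℝ) - 1 < ν₀) (c : Fin K → ℝ≥0) {δ : ℝ}
    (hδ : ∀ k, δ ≠ m k - ⨅ j, m j) :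
    Tendsto (fun t => (posterior m₀ l₀ Ψ₀ ν₀ (z t)).real
      {p | minComplexity δ c p.1 = minComplexity δ c m}) F (𝓝 1) := by
  obtain ⟨e, he, hsel⟩ := exists_minComplexity_eq c hδ
  obtain ⟨p, hp, hSp⟩ := eventually_mul_dotProduct_le hS
  set w : ι → Fin K → ℝ := fun t => sampleMean (z t) - m₀ with hw
  have hwlim : ∀ i j, Tendsto (fun t => |w t i * w t j|) F (𝓝 |(m - m₀) i * (m - m₀) j|) :=
    fun i j => ((tendsto_pi_nhds.1 (hm.sub_const m₀) i).mul
      (tendsto_pi_nhds.1 (hm.sub_const m₀) j)).abs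
  have hSlim : ∀ i j, Tendsto (fun t => |sampleCov (z t) i j|) F (𝓝 |S i j|) := fun i j =>
    (tendsto_pi_nhds.1 (tendsto_pi_nhds.1 hcov i) j).abs
  -- Entrywise bounds for `Ψ_n / n`: each `+ 1` is slack over a limit, and the coefficient `l₀ n /
  -- (l₀ + n)` is at most `l₀`.
  set c₀ : Fin K → Fin K → ℝ := fun i j =>
    |Ψ₀ i j| + (|S i j| + 1) + l₀ * (|(m - m₀) i * (m - m₀) j| + 1) with hc₀
  have hc₀0 : ∀ i j, 0 ≤ c₀ i j := fun i j => by positivity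
  set C : ℝ := ∑ i, ∑ j, c₀ i j with hC
  have hcC : ∀ i j, c₀ i j ≤ C := fun i j =>
    (Finset.single_le_sum (f := fun j => c₀ i j) (fun j _ => hc₀0 i j) (Finset.mem_univ j)).trans
      (Finset.single_le_sum (f := fun i => ∑ j, c₀ i j)
        (fun i _ => Finset.sum_nonneg fun j _ => hc₀0 i j) (Finset.mem_univ i))
  have hC0 : 0 ≤ C := Finset.sum_nonneg fun i _ => Finset.sum_nonneg fun j _ => hc₀0 i j
  have hNr : Tendsto (fun t => (N t : ℝ)) F atTop := tendsto_natCast_atTop_atTop.comp hN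
  have hinv : Tendsto (fun t => (l₀ + N t : ℝ)⁻¹) F (𝓝 0) :=
    tendsto_inv_atTop_zero.comp (tendsto_atTop_add_const_left _ _ hNr)
  have hcenter : Tendsto (fun t => (l₀ + N t : ℝ)⁻¹ • (l₀ • m₀ + (N t : ℝ) • sampleMean (z t)))
      F (𝓝 m) := by
    -- The centre is rewritten as the sample mean plus corrections carrying the vanishing factor
    -- `(l₀ + n)⁻¹`.
    have h1 := (hinv.smul_const (l₀ • (m₀ - m))).add (hm.sub
      ((hinv.const_mul l₀).smul (hm.sub_const m)))
    simp only [sub_self, mul_zero, zero_smul, zero_add, sub_zero] at h1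
    refine h1.congr fun t => ?_
    have hpos : (0 : ℝ) < l₀ + N t := by positivity
    ext k
    simp only [Pi.add_apply, Pi.sub_apply, Pi.smul_apply, smul_eq_mul]
    field_simp
    ring
  have hcenter' : ∀ᶠ t in F, ∀ k,
      |((l₀ + N t : ℝ)⁻¹ • (l₀ • m₀ + (N t : ℝ) • sampleMean (z t))) k - m k| < e := by
    refine eventually_all.2 fun k => ?_
    have := Metric.tendsto_nhds.1 (tendsto_pi_nhds.1 hcenter k) e he
    simpa only [Real.dist_eq] using this
  rw [Metric.tendsto_nhds]
  intro η hη
  have hη2 : ENNReal.ofReal (η / 2) ≠ 0 := by simpa using hη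
  filter_upwards [hN.eventually (eventually_normalInvWishart_concentration l₀ hl₀ ν₀ hν₀ hp hC0 he
    hη2), hcenter', hcov.eventually hSp, hN.eventually_ge_atTop 1,
    eventually_all.2 fun i => eventually_all.2 fun j =>
      (hwlim i j).eventually_le_const (lt_add_one _),
    eventually_all.2 fun i => eventually_all.2 fun j =>
      (hSlim i j).eventually_le_const (lt_add_one _)] with t hconc hcen hform hn1 hwt hSt
  have hn0 : (1 : ℝ) ≤ N t := by exact_mod_cast hn1
  have hcoef0 : 0 ≤ l₀ * N t / (l₀ + N t) := by positivity
  have hcoef : l₀ * N t / (l₀ + N t) ≤ l₀ := by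
    rw [div_le_iff₀ (by positivity)]
    nlinarith [sq_nonneg l₀]
  obtain ⟨huniv, htail⟩ := hconc
    ((l₀ + N t : ℝ)⁻¹ • (l₀ • m₀ + (N t : ℝ) • sampleMean (z t)))
    (Ψ₀ + (N t : ℝ) • sampleCov (z t) + (l₀ * N t / (l₀ + N t)) • Matrix.vecMulVec (w t) (w t))
    -- The prior scale and the rank-one term contribute nonnegative forms, so the sample covariance
    -- alone gives `p n`.
    (fun v => by
      have h1 : 0 ≤ v ⬝ᵥ (Ψ₀ *ᵥ v) := by
        simpa using hΨ₀.posSemidef.dotProduct_mulVec_nonneg v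
      have h2 : v ⬝ᵥ (Matrix.vecMulVec (w t) (w t) *ᵥ v) = (w t ⬝ᵥ v) ^ 2 := by
        rw [Matrix.vecMulVec_mulVec]
        simp [dotProduct_comm v, sq]
      rw [Matrix.add_mulVec, Matrix.add_mulVec, Matrix.smul_mulVec, Matrix.smul_mulVec,
        dotProduct_add, dotProduct_add, dotProduct_smul, dotProduct_smul, smul_eq_mul,
        smul_eq_mul, h2]
      have h3 := mul_le_mul_of_nonneg_left (hform v) (zero_le_one.trans hn0)
      have h4 := mul_nonneg hcoef0 (sq_nonneg (w t ⬝ᵥ v))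
      linarith)
    (fun i j => by
      refine le_trans ?_ (mul_le_mul_of_nonneg_right (hcC i j) (zero_le_one.trans hn0))
      simp only [Matrix.add_apply, Matrix.smul_apply, smul_eq_mul, Matrix.vecMulVec_apply]
      refine (abs_add_le _ _).trans ((add_le_add_left (abs_add_le _ _) _).trans ?_)
      rw [abs_mul, abs_mul (l₀ * N t / (l₀ + N t)), abs_of_nonneg hcoef0,
        abs_of_nonneg (zero_le_one.trans hn0), hc₀, add_mul, add_mul]
      refine add_le_add (add_le_add ?_ ?_) ?_
      · exact le_mul_of_one_le_right (abs_nonneg _) hn0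
      · rw [mul_comm]
        exact mul_le_mul_of_nonneg_right (hSt i j) (zero_le_one.trans hn0)
      · refine (mul_le_mul hcoef (hwt i j) (abs_nonneg _) hl₀.le).trans ?_
        exact le_mul_of_one_le_right (by positivity) hn0)
  set Q := posterior m₀ l₀ Ψ₀ ν₀ (z t) with hQ
  have hQprob : IsProbabilityMeasure Q := ⟨huniv⟩
  set A : Set ((Fin K → ℝ) × SymEntries K) :=
    {p | minComplexity δ c p.1 = minComplexity δ c m} with hA
  have hAc : Q Aᶜ ≤ ENNReal.ofReal (η / 2) := by
    refine (measure_mono fun x hx => ?_).trans htail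
    by_contra hfar
    refine hx (hsel x.1 fun k => ?_)
    have h1 := not_le.1 (not_exists.1 hfar k)
    have h2 := abs_sub_le (x.1 k)
      (((l₀ + N t : ℝ)⁻¹ • (l₀ • m₀ + (N t : ℝ) • sampleMean (z t))) k) (m k)
    linarith [hcen k]
  have hAc' : Q.real Aᶜ ≤ η / 2 := ENNReal.toReal_le_of_le_ofReal (half_pos hη).le hAc
  have hle : Q.real A ≤ 1 := measureReal_le_one
  have hge : 1 ≤ Q.real A + Q.real Aᶜ := by
    -- Subadditivity suffices, so measurability of `A` is not needed.
    have := measureReal_union_le (μ := Q) A Aᶜ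
    rwa [Set.union_compl_self, probReal_univ] at this
  rw [Real.dist_eq, abs_lt]
  constructor <;> linarith

end Selection

end LaD

theorem mainTheorem9
    {Ω 𝒳 : Type*} [MeasurableSpace Ω] [MeasurableSpace 𝒳]
    (P : Measure Ω) [IsProbabilityMeasure P]
    (P₀ : Measure 𝒳) [IsProbabilityMeasure P₀]
    -- the i.i.d. observations `X 0, X 1, …` with distribution `P₀`
    (X : ℕ → Ω → 𝒳) (hX_meas : ∀ i, Measurable (X i)) (hX_indep : iIndepFun X P)
    (hX_law : ∀ i, P.map (X i) = P₀)
    -- the models: parameter sets, losses, optimal parameters, estimators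
    {K : ℕ} [NeZero K] (d : Fin K → ℕ)
    (Θ : (k : Fin K) → Set (EuclideanSpace ℝ (Fin (d k))))
    (ℓ : (k : Fin K) → 𝒳 → EuclideanSpace ℝ (Fin (d k)) → ℝ)
    (θs : (k : Fin K) → EuclideanSpace ℝ (Fin (d k)))
    (θh : (k : Fin K) → (n : ℕ) → (Fin n → 𝒳) → EuclideanSpace ℝ (Fin (d k)))
    (h_moment : ∀ k, MemLp (fun x => ℓ k x (θs k)) 2 P₀)
    (h_cov : (LaD.trueCov P₀ ℓ θs).PosDef)
    (h_reg : ∀ k, LaD.RegularModel P X P₀ (Θ k) (ℓ k) (θs k) (θh k))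
    -- the hyperparameters of the prior
    (m₀ : Fin K → ℝ) (l₀ : ℝ) (hl₀ : 0 < l₀)
    (Ψ₀ : Matrix (Fin K) (Fin K) ℝ) (hΨ₀ : Ψ₀.PosDef)
    (ν₀ : ℝ) (hν₀ : (K : ℝ) - 1 < ν₀)
    -- the complexities and the tolerance
    (c : Fin K → ℝ≥0) (δ : ℝ) (hδ : 0 ≤ δ)
    (hδ_ne : ∀ k, δ ≠ LaD.trueMean P₀ ℓ θs k - ⨅ j, LaD.trueMean P₀ ℓ θs j) :
    TendstoInMeasure P
      (fun (n : ℕ) (ω : Ω) =>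
        (LaD.posterior m₀ l₀ Ψ₀ ν₀
            (LaD.lossData ℓ θh (fun i : Fin n => X i ω))).real
          {p | LaD.minComplexity δ c p.1 = LaD.minComplexity δ c (LaD.trueMean P₀ ℓ θs)})
      atTop (fun _ => (1 : ℝ)) := by
  refine LaD.tendstoInMeasure_const_iff.2 ?_
  exact LaD.tendsto_posterior_minComplexity (LaD.tendsto_fst_withHighProbability P) h_cov
    (LaD.tendsto_sampleMean_lossData hX_meas hX_indep hX_law h_moment h_reg)
    (LaD.tendsto_sampleCov_lossData hX_meas hX_indep hX_law h_moment h_reg)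
    m₀ hl₀ hΨ₀ hν₀ c hδ_ne
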